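/- **Setting.** A self-similar group $(G,\mathfrak B)$ is a group $G$ with a set $\mathfrak B$ carrying commuting left and right actions of $G$ such that the right action is free and has finitely many orbits. A basis $\mathsf X\subset\mathfrak B$ is a set meeting every right orbit exactly once. For $g\in G$ and a word $v=x_1\ldots x_n\in\mathsf X^n$ (identified with $x_1\otimes\cdots\otimes x_n\in\mathfrak B^{\otimes n}$), the word $g(v)\in\mathsf X^n$ and the section $g|_v\in G$ are defined by $g\cdot v=g(v)\cdot g|_v$; this gives actions of $G$ on the rooted tree $\mathsf X^*=\bigcup_{n\ge 0}\mathsf X^n$ and on its boundary $\mathsf X^\omega$. The group is contracting if for some basis $\mathsf X$ there is a finite set $\mathcal N\subset G$ such that for every $g\in G$ there is $n$ with $g|_v\in\mathcal N$ for all words $v$ of length at least $n$ (this then holds for every basis). The nucleus (with respect to $\mathsf X$) is the smallest such $\mathcal N$. The limit $G$-space $\mathcal X_G$ is the quotient of $\mathsf X^{-\omega}\times G$ (left-infinite sequences $\ldots x_2x_1$ with the product topology, $G$ discrete) by the relation under which $\ldots x_2x_1\cdot g$ and $\ldots y_2y_1\cdot h$ are equivalent if and only if there is a sequence $g_n$ of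 elements of a finite subset of $G$ with $g_n\cdot x_n\ldots x_1\cdot g=y_n\ldots y_1\cdot h$ in $\mathfrak B^{\otimes n}$ for every $n$. The limit space is the space of orbits $\mathcal J_G=\mathcal X_G/G$ of the right action of $G$. The groupoid of germs $\mathfrak G$ of the action of $G$ on $\mathsf X^\omega$ is the quotient of the action groupoid $G\times\mathsf X^\omega$ ($G$ discrete) by the relation identifying $(g_1,x)$ and $(g_2,x)$ whenever $g_1$ and $g_2$ coincide on a neighborhood of $x$, with the quotient topology. The dynamical asymptotic dimension of a topological groupoid $\mathfrak G$ is the smallest $d$ such that for every compact $C\subset\mathfrak G$ there is an open cover $\{U_0,\ldots,U_d\}$ of the space of units for which every set $\{\gamma\in C: \text{the source and the range of }\gamma\text{ lie in }U_i\}$ is contained in a compact subgroupoid of $\mathfrak G$. (Compactness does not include the Hausdorff property.) **Theorem.** Let $(G,\mathfrak B)$ be a contracting self-similar group, let $\mathsf X$ be a basis of $\mathfrak B$, and let $d\ge 0$ be an integer. The following conditions are equivalent. 1. The covering dimension of the limit space $\mathcal J_G$ is at most $d$. 2. For every finite set $A\subset G$ there exist $n\ge 1$ and a partition of $\mathsf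 X^n$ into $d+1$ (possibly empty) sets $V_0,\ldots,V_d$ such that for every $i$ the groupoid of isomorphisms between the subtrees $v\mathsf X^*$ ($v\in V_i$) generated by the restrictions $g:v\mathsf X^*\to g(v)\mathsf X^*$, for $g\in A$ and $v\in V_i$ with $g(v)\in V_i$, is finite. 3. The condition in (2) holds for $A$ equal to the nucleus. 4. The dynamical asymptotic dimension of the groupoid of germs of the action of $G$ on $\mathsf X^\omega$ is at most $d$. -/

import Mathlib

open CategoryTheory Topology
open scoped Pointwise

universe u v

/-! ### Self-similar groups -/

/-- A self-similar group `(G, B)`: a set `B` with commuting left and right actions of `G` (the right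
action is written as an action of `Gᵐᵒᵖ`) such that the right action is free and has finitely many
orbits. -/
class SelfSimilarGroup (G : Type u) (B : Type v) [Group G] [MulAction G B] [MulAction Gᵐᵒᵖ B]
    [SMulCommClass G Gᵐᵒᵖ B] : Prop where
  free : ∀ (b : B) (g : G), MulOpposite.op g • b = b → g = 1
  finite_orbits : Finite (MulAction.orbitRel.Quotient Gᵐᵒᵖ B)

/-- A basis of a biset: a subset that meets every right orbit exactly once. -/
structure BisetBasis (G : Type u) (B : Type v) [Group G] [MulAction Gᵐᵒᵖ B] where
  carrier : Set B
  exists_unique_mem : ∀ b : B, ∃! x : B, x ∈ carrier ∧ x ∈ MulAction.orbit Gᵐᵒᵖ b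

namespace BisetBasis

variable {G : Type u} {B : Type v} [Group G] [MulAction Gᵐᵒᵖ B]

/-- The elements of the basis, as an alphabet. -/
abbrev Letter (X : BisetBasis G B) : Type v := ↥X.carrier

/-- The alphabet is discrete. -/
instance (X : BisetBasis G B) : TopologicalSpace X.Letter := ⊥

instance (X : BisetBasis G B) : DiscreteTopology X.Letter := ⟨rfl⟩

theorem exists_decomp (X : BisetBasis G B) (b : B) :
    ∃ p : X.Letter × G, MulOpposite.op p.2 • p.1.1 = b := by
  obtain ⟨x, ⟨hx, hxb⟩, -⟩ := X.exists_unique_mem b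
  rw [MulAction.mem_orbit_symm] at hxb
  obtain ⟨g, hg⟩ := hxb
  exact ⟨(⟨x, hx⟩, g.unop), hg⟩

/-- The letter `x` in the decomposition `b = x · g`. -/
noncomputable def rep (X : BisetBasis G B) (b : B) : X.Letter := (X.exists_decomp b).choose.1

/-- The group element `g` in the decomposition `b = x · g`. -/
noncomputable def coef (X : BisetBasis G B) (b : B) : G := (X.exists_decomp b).choose.2

theorem rep_coef (X : BisetBasis G B) (b : B) :
    MulOpposite.op (X.coef b) • (X.rep b).1 = b :=
  (X.exists_decomp b).choose_spec

variable [MulAction G B]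

/-- The letter `g(x)`, defined by `g · x = g(x) · g|ₓ`. -/
noncomputable def letterAct (X : BisetBasis G B) (g : G) (x : X.Letter) : X.Letter :=
  X.rep (g • x.1)

/-- The section `g|ₓ`, defined by `g · x = g(x) · g|ₓ`. -/
noncomputable def letterSec (X : BisetBasis G B) (g : G) (x : X.Letter) : G :=
  X.coef (g • x.1)

/-- Finite words over the alphabet: the vertices of the rooted tree. The word `[x₁, …, xₙ]` stands
for the element `x₁ ⊗ ⋯ ⊗ xₙ` of the `n`-th tensor power of the biset. -/
abbrev Word (X : BisetBasis G B) : Type v := List X.Letter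

/-- The section `g|ᵥ` at a word: `g · v = g(v) · g|ᵥ` in the tensor power of the biset. -/
noncomputable def sec (X : BisetBasis G B) : G → X.Word → G
  | g, [] => g
  | g, x :: v => X.sec (X.letterSec g x) v

/-- The image `g(v)` of a word: `g · v = g(v) · g|ᵥ` in the tensor power of the biset. -/
noncomputable def act (X : BisetBasis G B) : G → X.Word → X.Word
  | _, [] => []
  | g, x :: v => X.letterAct g x :: X.act (X.letterSec g x) v

/-! ### Contraction and the nucleus -/

/-- For every `g` there is `n` such that `g|ᵥ ∈ N` for all words `v` of length at least `n`. -/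
def Absorbs (X : BisetBasis G B) (N : Set G) : Prop :=
  ∀ g : G, ∃ n : ℕ, ∀ v : X.Word, n ≤ v.length → X.sec g v ∈ N

/-- The nucleus: the smallest finite set that absorbs all long sections
(see `isLeast_nucleus`). -/
def nucleus (X : BisetBasis G B) : Set G := ⋂₀ {N : Set G | N.Finite ∧ X.Absorbs N}

/-- If there is a finite absorbing set, then the nucleus is the smallest one. -/
theorem isLeast_nucleus (X : BisetBasis G B) (h : ∃ N : Set G, N.Finite ∧ X.Absorbs N) :
    IsLeast {N : Set G | N.Finite ∧ X.Absorbs N} X.nucleus := by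
  classical
  have hinter : ∀ N M : Set G, X.Absorbs N → X.Absorbs M → X.Absorbs (N ∩ M) := by
    intro N M hN hM g
    obtain ⟨n, hn⟩ := hN g
    obtain ⟨m, hm⟩ := hM g
    exact ⟨max n m, fun v hv => ⟨hn v (le_trans (le_max_left _ _) hv),
      hm v (le_trans (le_max_right _ _) hv)⟩⟩
  have hP : ∃ k : ℕ, ∃ N : Set G, (N.Finite ∧ X.Absorbs N) ∧ N.ncard = k := by
    obtain ⟨N, hN⟩ := h
    exact ⟨_, N, hN, rfl⟩
  obtain ⟨N, hN, hk⟩ := Nat.find_spec hP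
  have hleast : ∀ M ∈ {N : Set G | N.Finite ∧ X.Absorbs N}, N ⊆ M := by
    intro M hM
    have h1 : Nat.find hP ≤ (N ∩ M).ncard :=
      Nat.find_min' hP ⟨N ∩ M, ⟨hN.1.inter_of_left M, hinter N M hN.2 hM.2⟩, rfl⟩
    have h2 : N ∩ M = N :=
      Set.eq_of_subset_of_ncard_le Set.inter_subset_left (hk ▸ h1) hN.1
    exact Set.inter_eq_left.mp h2
  have heq : X.nucleus = N :=
    Set.Subset.antisymm (Set.sInter_subset_of_mem hN) (Set.subset_sInter hleast)
  rw [heq]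
  exact ⟨hN, hleast⟩

end BisetBasis

/-- A self-similar group is contracting if, for some basis of the biset, there is a finite set that
contains all sufficiently deep sections of every group element. -/
def IsContracting (G : Type u) (B : Type v) [Group G] [MulAction G B] [MulAction Gᵐᵒᵖ B] : Prop :=
  ∃ (X : BisetBasis G B) (N : Set G), N.Finite ∧ X.Absorbs N

namespace BisetBasis

variable {G : Type u} {B : Type v} [Group G] [MulAction G B] [MulAction Gᵐᵒᵖ B]

/-! ### Algebra of sections -/

theorem letter_spec (X : BisetBasis G B) (g : G) (x : X.Letter) :
    MulOpposite.op (X.letterSec g x) • (X.letterAct g x).1 = g • x.1 :=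
  X.rep_coef (g • x.1)

theorem act_append (X : BisetBasis G B) (g : G) (v w : X.Word) :
    X.act g (v ++ w) = X.act g v ++ X.act (X.sec g v) w := by
  induction v generalizing g with
  | nil => rfl
  | cons x v ih => simp [act, sec, ih]

section Algebra

variable [SMulCommClass G Gᵐᵒᵖ B] [SelfSimilarGroup G B]

theorem decomp_unique (X : BisetBasis G B) {x y : X.Letter} {g h : G}
    (e : MulOpposite.op g • x.1 = MulOpposite.op h • y.1) : x = y ∧ g = h := by
  have hxy : x = y := by
    refine Subtype.ext ((X.exists_unique_mem x.1).unique
      ⟨x.2, MulAction.mem_orbit_self _⟩ ⟨y.2, ?_⟩)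
    refine ⟨(MulOpposite.op h)⁻¹ * MulOpposite.op g, ?_⟩
    change ((MulOpposite.op h)⁻¹ * MulOpposite.op g) • x.1 = y.1
    rw [mul_smul, e, inv_smul_smul]
  subst hxy
  refine ⟨rfl, ?_⟩
  have h1 : MulOpposite.op (g * h⁻¹) • x.1 = x.1 := by
    rw [MulOpposite.op_mul, mul_smul, e, ← mul_smul, ← MulOpposite.op_mul, mul_inv_cancel,
      MulOpposite.op_one, one_smul]
  exact mul_inv_eq_one.mp (SelfSimilarGroup.free _ _ h1)

theorem letter_one (X : BisetBasis G B) (x : X.Letter) :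
    X.letterAct (1 : G) x = x ∧ X.letterSec (1 : G) x = 1 := by
  apply X.decomp_unique
  rw [letter_spec, one_smul, MulOpposite.op_one, one_smul]

theorem letter_mul (X : BisetBasis G B) (g h : G) (x : X.Letter) :
    X.letterAct (g * h) x = X.letterAct g (X.letterAct h x) ∧
      X.letterSec (g * h) x = X.letterSec g (X.letterAct h x) * X.letterSec h x := by
  apply X.decomp_unique
  rw [letter_spec, MulOpposite.op_mul, mul_smul, mul_smul, letter_spec, ← smul_comm g,
    letter_spec]

theorem act_one (X : BisetBasis G B) (v : X.Word) : X.act (1 : G) v = v := by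
  induction v with
  | nil => rfl
  | cons x v ih => simp [act, (X.letter_one x).1, (X.letter_one x).2, ih]

theorem sec_one (X : BisetBasis G B) (v : X.Word) : X.sec (1 : G) v = 1 := by
  induction v with
  | nil => rfl
  | cons x v ih => simp [sec, (X.letter_one x).2, ih]

theorem act_mul (X : BisetBasis G B) (g h : G) (v : X.Word) :
    X.act (g * h) v = X.act g (X.act h v) := by
  induction v generalizing g h with
  | nil => rfl
  | cons x v ih => simp [act, (X.letter_mul g h x).1, (X.letter_mul g h x).2, ih]

theorem sec_mul (X : BisetBasis G B) (g h : G) (v : X.Word) :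
    X.sec (g * h) v = X.sec g (X.act h v) * X.sec h v := by
  induction v generalizing g h with
  | nil => rfl
  | cons x v ih => simp [sec, act, (X.letter_mul g h x).2, ih]

/-- The permutation of the set of words given by a group element. -/
noncomputable def wordPerm (X : BisetBasis G B) (g : G) : Equiv.Perm X.Word where
  toFun := X.act g
  invFun := X.act g⁻¹
  left_inv v := by rw [← act_mul, inv_mul_cancel, act_one]
  right_inv v := by rw [← act_mul, mul_inv_cancel, act_one]

/-! ### Groupoids of isomorphisms between subtrees -/

/-- The set of vertices of the subtree of words with prefix `v`. -/
abbrev Subtree (X : BisetBasis G B) (v : X.Word) : Type v := {w : X.Word // v <+: w}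

theorem prefix_iff_act (X : BisetBasis G B) (g : G) (v w : X.Word) :
    v <+: w ↔ X.act g v <+: X.wordPerm g w := by
  have key : ∀ (g : G) (v w : X.Word), v <+: w → X.act g v <+: X.act g w := by
    rintro g v w ⟨t, rfl⟩
    exact ⟨_, (X.act_append g v t).symm⟩
  refine ⟨key g v w, fun h => ?_⟩
  have h' := key g⁻¹ _ _ h
  change X.act g⁻¹ (X.act g v) <+: X.act g⁻¹ (X.act g w) at h'
  rwa [← act_mul, ← act_mul, inv_mul_cancel, act_one, act_one] at h'

/-- The restriction of the action of `g` to an isomorphism from the subtree at `v` to the subtree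
at `g(v)`. -/
noncomputable def restrictIso (X : BisetBasis G B) (g : G) (v : X.Word) :
    X.Subtree v ≃ X.Subtree (X.act g v) :=
  (X.wordPerm g).subtypeEquiv (X.prefix_iff_act g v)

/-- Membership in the groupoid of isomorphisms between the subtrees at the vertices `v ∈ V` that is
generated by the restrictions of `g ∈ A` to the subtrees at those `v ∈ V` for which `g(v) ∈ V`. -/
inductive GeneratedIso (X : BisetBasis G B) (A : Set G) (V : Set X.Word) :
    (v w : X.Word) → (X.Subtree v ≃ X.Subtree w) → Prop
  | of (g : G) (v : X.Word) (hg : g ∈ A) (hv : v ∈ V) (hgv : X.act g v ∈ V) :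
      GeneratedIso X A V v (X.act g v) (X.restrictIso g v)
  | refl (v : X.Word) (hv : v ∈ V) : GeneratedIso X A V v v (Equiv.refl _)
  | symm {v w : X.Word} {φ : X.Subtree v ≃ X.Subtree w} (h : GeneratedIso X A V v w φ) :
      GeneratedIso X A V w v φ.symm
  | trans {v w z : X.Word} {φ : X.Subtree v ≃ X.Subtree w} {ψ : X.Subtree w ≃ X.Subtree z}
      (h : GeneratedIso X A V v w φ) (h' : GeneratedIso X A V w z ψ) :
      GeneratedIso X A V v z (φ.trans ψ)

/-- The groupoid generated by the restrictions of elements of `A` within `V` is finite. -/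
def FiniteGroupoid (X : BisetBasis G B) (A : Set G) (V : Set X.Word) : Prop :=
  {γ : Σ v w : X.Word, X.Subtree v ≃ X.Subtree w | X.GeneratedIso A V γ.1 γ.2.1 γ.2.2}.Finite

/-- For some `n ≥ 1` the level `n` of the tree has a partition into `d + 1` (possibly empty) parts
`V₀, …, V_d` such that, for each part, the groupoid generated by the restrictions of the elements of
`A` within the part is finite. -/
def HasFinitePartition (X : BisetBasis G B) (A : Set G) (d : ℕ) : Prop :=
  ∃ n : ℕ, 1 ≤ n ∧ ∃ V : Fin (d + 1) → Set X.Word,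
    (⋃ i, V i) = {v : X.Word | v.length = n} ∧ Pairwise (fun i j => Disjoint (V i) (V j)) ∧
      ∀ i, X.FiniteGroupoid A (V i)

end Algebra

/-! ### The limit space -/

/-- Left-infinite sequences `… x₂ x₁`, with the product topology; `x k` is the letter `xₖ₊₁`. -/
def LeftSeq (X : BisetBasis G B) : Type v := ℕ → X.Letter

instance (X : BisetBasis G B) : TopologicalSpace X.LeftSeq :=
  inferInstanceAs (TopologicalSpace (ℕ → X.Letter))

/-- The finite word `xₙ … x₂ x₁`. -/
def LeftSeq.trunc {X : BisetBasis G B} (x : X.LeftSeq) : ℕ → X.Word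
  | 0 => []
  | n + 1 => x n :: x.trunc n

section Limit

variable [SMulCommClass G Gᵐᵒᵖ B] [SelfSimilarGroup G B]

/-- Asymptotic equivalence of `… x₂ x₁ · g` and `… y₂ y₁ · h`: there is a sequence `gₙ` in a finite
subset of `G` with `gₙ · xₙ … x₁ · g = yₙ … y₁ · h` for all `n`, that is, `gₙ(xₙ … x₁) = yₙ … y₁`
and `gₙ|_{xₙ … x₁} g = h`. -/
def AsympEquiv (X : BisetBasis G B) (p q : X.LeftSeq × G) : Prop :=
  ∃ F : Set G, F.Finite ∧ ∃ a : ℕ → G, (∀ n, a n ∈ F) ∧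
    ∀ n, X.act (a n) (p.1.trunc n) = q.1.trunc n ∧ X.sec (a n) (p.1.trunc n) * p.2 = q.2

theorem asympEquiv_equivalence (X : BisetBasis G B) : Equivalence X.AsympEquiv where
  refl p := ⟨{1}, Set.finite_singleton 1, fun _ => 1, fun _ => rfl, fun n =>
    ⟨X.act_one _, by rw [sec_one, one_mul]⟩⟩
  symm := by
    rintro p q ⟨F, hF, a, ha, h⟩
    refine ⟨F⁻¹, hF.inv, fun n => (a n)⁻¹, fun n => Set.inv_mem_inv.mpr (ha n), fun n => ?_⟩
    have h1 : X.act (a n)⁻¹ (q.1.trunc n) = p.1.trunc n := by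
      rw [← (h n).1, ← act_mul, inv_mul_cancel, act_one]
    refine ⟨h1, ?_⟩
    rw [← (h n).2, ← mul_assoc, ← (h n).1, ← sec_mul, inv_mul_cancel, sec_one, one_mul]
  trans := by
    rintro p q r ⟨F, hF, a, ha, h⟩ ⟨F', hF', b, hb, h'⟩
    refine ⟨F' * F, hF'.mul hF, fun n => b n * a n, fun n => Set.mul_mem_mul (hb n) (ha n),
      fun n => ⟨?_, ?_⟩⟩
    · rw [act_mul, (h n).1, (h' n).1]
    · rw [sec_mul, (h n).1, mul_assoc, (h n).2, (h' n).2]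

/-- Asymptotic equivalence as a setoid. -/
def asympSetoid (X : BisetBasis G B) : Setoid (X.LeftSeq × G) := ⟨_, X.asympEquiv_equivalence⟩

/-- The limit `G`-space: the quotient of the product of the space of left-infinite sequences with
the discrete group `G` by asymptotic equivalence. -/
def LimitGSpace (X : BisetBasis G B) : Type (max u v) := Quotient X.asympSetoid

instance (X : BisetBasis G B) : TopologicalSpace X.LimitGSpace :=
  letI : TopologicalSpace G := ⊥
  inferInstanceAs (TopologicalSpace (Quotient X.asympSetoid))

/-- The right action of `G` on the limit `G`-space: `(… x₂ x₁ · g) · h = … x₂ x₁ · gh`. -/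
instance (X : BisetBasis G B) : MulAction Gᵐᵒᵖ X.LimitGSpace where
  smul h := Quotient.map (fun p => (p.1, p.2 * h.unop)) (by
    rintro p q ⟨F, hF, a, ha, e⟩
    exact ⟨F, hF, a, ha, fun n => ⟨(e n).1, by
      change X.sec (a n) (p.1.trunc n) * (p.2 * h.unop) = q.2 * h.unop
      rw [← mul_assoc, (e n).2]⟩⟩)
  one_smul := by
    rintro ⟨p⟩
    exact congrArg (Quotient.mk X.asympSetoid) (Prod.ext rfl (mul_one p.2))
  mul_smul := by
    rintro h k ⟨p⟩
    exact congrArg (Quotient.mk X.asympSetoid)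
      (Prod.ext rfl (mul_assoc p.2 k.unop h.unop).symm)

/-- The limit space: the space of `G`-orbits of the limit `G`-space. -/
abbrev LimitSpace (X : BisetBasis G B) : Type (max u v) :=
  MulAction.orbitRel.Quotient Gᵐᵒᵖ X.LimitGSpace

end Limit

/-! ### The action on the boundary of the tree -/

/-- The boundary of the tree: right-infinite sequences `x₁ x₂ …` with the product topology;
`x k` is the letter `xₖ₊₁`. -/
def Boundary (X : BisetBasis G B) : Type v := ℕ → X.Letter

instance (X : BisetBasis G B) : TopologicalSpace X.Boundary :=
  inferInstanceAs (TopologicalSpace (ℕ → X.Letter))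

/-- The section of `g` at the prefix of length `n` of an infinite sequence. -/
noncomputable def prefixSec (X : BisetBasis G B) (g : G) (x : X.Boundary) : ℕ → G
  | 0 => g
  | n + 1 => X.letterSec (X.prefixSec g x n) (x n)

/-- The action of `G` on the boundary, letter by letter. -/
noncomputable instance (X : BisetBasis G B) : SMul G X.Boundary where
  smul g x := fun n => X.letterAct (X.prefixSec g x n) (x n)

theorem boundary_smul_apply (X : BisetBasis G B) (g : G) (x : X.Boundary) (n : ℕ) :
    (g • x) n = X.letterAct (X.prefixSec g x n) (x n) := rfl

theorem continuous_boundary_smul (X : BisetBasis G B) (g : G) :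
    Continuous (fun x : X.Boundary => g • x) := by
  let _ : TopologicalSpace G := ⊥
  have : DiscreteTopology G := ⟨rfl⟩
  have hev : ∀ n, Continuous (fun x : X.Boundary => x n) := fun n =>
    continuous_apply (A := fun _ : ℕ => X.Letter) n
  have hsec : ∀ n, Continuous (fun x : X.Boundary => X.prefixSec g x n) := by
    intro n
    induction n with
    | zero => exact continuous_const
    | succ n ih =>
      exact (continuous_of_discreteTopology (f := fun p : G × X.Letter => X.letterSec p.1 p.2)).comp
        (ih.prodMk (hev n))
  refine continuous_pi (A := fun _ : ℕ => X.Letter) fun n => ?_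
  exact (continuous_of_discreteTopology (f := fun p : G × X.Letter => X.letterAct p.1 p.2)).comp
    ((hsec n).prodMk (hev n))

section BoundaryAction

variable [SMulCommClass G Gᵐᵒᵖ B] [SelfSimilarGroup G B]

theorem prefixSec_one (X : BisetBasis G B) (x : X.Boundary) (n : ℕ) :
    X.prefixSec (1 : G) x n = 1 := by
  induction n with
  | zero => rfl
  | succ n ih => rw [prefixSec, ih, (X.letter_one (x n)).2]

theorem prefixSec_mul (X : BisetBasis G B) (g h : G) (x : X.Boundary) (n : ℕ) :
    X.prefixSec (g * h) x n = X.prefixSec g (h • x) n * X.prefixSec h x n := by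
  induction n with
  | zero => rfl
  | succ n ih =>
    rw [prefixSec, ih, (X.letter_mul _ _ (x n)).2, prefixSec, prefixSec, boundary_smul_apply]

noncomputable instance (X : BisetBasis G B) : MulAction G X.Boundary where
  one_smul x := by
    funext n
    rw [boundary_smul_apply, prefixSec_one, (X.letter_one (x n)).1]
  mul_smul g h x := by
    funext n
    rw [boundary_smul_apply, prefixSec_mul, (X.letter_mul _ _ (x n)).1, boundary_smul_apply,
      boundary_smul_apply]

/-! ### The groupoid of germs -/

/-- Two group elements that map `x` to `y` have the same germ at `x` if they act in the same way on
a neighbourhood of `x`. -/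
def germSetoid (X : BisetBasis G B) (x y : X.Boundary) : Setoid {g : G // g • x = y} where
  r g h := ∀ᶠ z in 𝓝 x, g.1 • z = h.1 • z
  iseqv :=
    { refl := fun _ => Filter.Eventually.of_forall fun _ => rfl
      symm := fun h => h.mono fun _ e => e.symm
      trans := fun h k => (h.and k).mono fun _ e => e.1.trans e.2 }

/-- The germs with source `x` and range `y`. -/
def GermHom (X : BisetBasis G B) (x y : X.Boundary) : Type u := Quotient (X.germSetoid x y)

/-- Composition of germs: the germ of `g` at `x` followed by the germ of `h` at `g(x)` is the germ
of `hg` at `x`. -/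
def GermHom.comp {X : BisetBasis G B} {x y z : X.Boundary} :
    X.GermHom x y → X.GermHom y z → X.GermHom x z :=
  Quotient.map₂ (fun g h => ⟨h.1 * g.1, by rw [mul_smul, g.2, h.2]⟩) (by
    intro g g' hg h h' hh
    have hc : Filter.Tendsto (fun t : X.Boundary => g.1 • t) (𝓝 x) (𝓝 y) := by
      have := (X.continuous_boundary_smul g.1).tendsto x
      rwa [g.2] at this
    refine ((hc.eventually hh).and hg).mono fun t e => ?_
    change (h.1 * g.1) • t = (h'.1 * g'.1) • t
    rw [mul_smul, mul_smul, ← e.2, e.1])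

/-- The inverse of the germ of `g` at `x` is the germ of `g⁻¹` at `g(x)`. -/
def GermHom.inv {X : BisetBasis G B} {x y : X.Boundary} : X.GermHom x y → X.GermHom y x :=
  Quotient.map (fun g => ⟨g.1⁻¹, by rw [inv_smul_eq_iff, g.2]⟩) (by
    intro g g' hg
    have hc : Filter.Tendsto (fun t : X.Boundary => g.1⁻¹ • t) (𝓝 y) (𝓝 x) := by
      have := (X.continuous_boundary_smul g.1⁻¹).tendsto y
      rwa [inv_smul_eq_iff.mpr g.2.symm] at this
    refine (hc.eventually hg).mono fun t e => ?_
    change g.1⁻¹ • t = g'.1⁻¹ • t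
    rw [smul_inv_smul] at e
    rw [eq_inv_smul_iff, ← e])

/-- The groupoid of germs of the action of `G` on the boundary of the tree: the objects are the
points of the boundary and the morphisms from `x` to `y` are the germs at `x` of elements of `G`
that map `x` to `y`. -/
instance germGroupoid (X : BisetBasis G B) : Groupoid.{u} X.Boundary where
  Hom x y := X.GermHom x y
  id x := Quotient.mk _ ⟨1, one_smul G x⟩
  comp f g := f.comp g
  inv f := f.inv
  id_comp := by
    rintro x y ⟨g⟩
    exact congrArg (Quotient.mk (X.germSetoid x y)) (Subtype.ext (mul_one g.1))
  comp_id := by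
    rintro x y ⟨g⟩
    exact congrArg (Quotient.mk (X.germSetoid x y)) (Subtype.ext (one_mul g.1))
  assoc := by
    rintro w x y z ⟨f⟩ ⟨g⟩ ⟨h⟩
    exact congrArg (Quotient.mk (X.germSetoid w z)) (Subtype.ext (mul_assoc h.1 g.1 f.1).symm)
  inv_comp := by
    rintro x y ⟨g⟩
    exact congrArg (Quotient.mk (X.germSetoid y y)) (Subtype.ext (mul_inv_cancel g.1))
  comp_inv := by
    rintro x y ⟨g⟩
    exact congrArg (Quotient.mk (X.germSetoid x x)) (Subtype.ext (inv_mul_cancel g.1))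

/-- The germ of `g` at `x`, as an element of the set of all morphisms. -/
noncomputable def germ (X : BisetBasis G B) (p : G × X.Boundary) : Quiver.Total X.Boundary :=
  ⟨p.2, p.1 • p.2, Quotient.mk (X.germSetoid p.2 (p.1 • p.2)) ⟨p.1, rfl⟩⟩

/-- The set of germs has the quotient topology of the action groupoid `G × ∂`, where `∂` is the
boundary and `G` is discrete. -/
noncomputable instance germTopology (X : BisetBasis G B) : TopologicalSpace (Quiver.Total X.Boundary) :=
  letI : TopologicalSpace G := ⊥
  TopologicalSpace.coinduced X.germ inferInstance

end BoundaryAction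

end BisetBasis

/-! ### Dimensions -/

/-- The covering dimension of `Y` is at most `d`: every open cover has an open refinement such that
every point lies in at most `d + 1` of its elements. -/
def CoveringDimLE (Y : Type u) [TopologicalSpace Y] (d : ℕ) : Prop :=
  ∀ 𝒰 : Set (Set Y), (∀ U ∈ 𝒰, IsOpen U) → ⋃₀ 𝒰 = Set.univ →
    ∃ 𝒱 : Set (Set Y), (∀ V ∈ 𝒱, IsOpen V) ∧ ⋃₀ 𝒱 = Set.univ ∧
      (∀ V ∈ 𝒱, ∃ U ∈ 𝒰, V ⊆ U) ∧ ∀ y : Y, {V ∈ 𝒱 | y ∈ V}.encard ≤ d + 1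

section Dad

variable (C : Type v) [Groupoid.{u} C] [TopologicalSpace (Quiver.Total C)]

/-- The topology of the space of units: an object is identified with its identity morphism. -/
abbrev unitTopology : TopologicalSpace C :=
  TopologicalSpace.induced (fun c : C => (⟨c, c, 𝟙 c⟩ : Quiver.Total C)) inferInstance

/-- For every compact set `K` of morphisms there is an open cover `U₀, …, U_d` of the space of units
such that, for every `i`, the morphisms in `K` with source and range in `Uᵢ` are contained in a
compact subgroupoid. -/
def DadProperty (d : ℕ) : Prop :=
  ∀ K : Set (Quiver.Total C), IsCompact K →
    ∃ U : Fin (d + 1) → Set C, (∀ i, IsOpen[unitTopology C] (U i)) ∧ (⋃ i, U i) = Set.univ ∧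
      ∀ i, ∃ H : Subgroupoid C,
        IsCompact {γ : Quiver.Total C | γ.hom ∈ H.arrows γ.left γ.right} ∧
          ∀ γ ∈ K, γ.left ∈ U i → γ.right ∈ U i → γ.hom ∈ H.arrows γ.left γ.right

/-- The dynamical asymptotic dimension of a groupoid with a topology on its set of morphisms: the
smallest `d` with the above property (`⊤` if there is none). -/
noncomputable def dynAsympDim : ℕ∞ := ⨅ (d : ℕ) (_ : DadProperty C d), (d : ℕ∞)

end Dad

namespace BisetBasis

variable {G : Type u} {B : Type v} [Group G] [MulAction G B] [MulAction Gᵐᵒᵖ B]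

/-! ### Words and sections -/

/-! Everything is reduced to a finite core: a finite symmetric set `N`, closed under sections,
containing `1` and absorbing deep sections (`exists_isCore`). Contraction for one basis yields such
a set for every basis. An element of the groupoid generated within a finite set of words is a path
of generators (`LocalGen`), and the groupoid is finite exactly when the sections along such paths
induce finitely many transformations of the tree (`finiteGroupoid_iff`). Prefixing all words of a
fixed length turns generators from a finite set into generators from an absorbing set, so a
partition for one absorbing set yields one for every finite set (`HasFinitePartition.of_absorbs`).
It remains to relate partitions for products of core elements to the two dimensions.

From a partition to a cover (`IsCore.coveringDimLE`): extend the coloured words to the right and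
group each colour into components under `N * N`. Finiteness of the groupoids makes the components
small in the limit space, and words representing one point differ by elements of `N`, so a point
meets at most one component of each colour.

From a cover to a partition (`IsCore.hasFinitePartition_of_coveringDimLE`): attach to each long word
the sets of a fine cover that contain its tile together with a neighbourhood of it, the radius being
chosen so that this family does not change when the radius grows by one. Colour by the size of the
family. Adjacent words of one colour have the same family, so a whole component stays in one small
set of the cover, and there the sections are controlled by the finite stabilizer of a point of the
limit `G`-space.

For germs, a compact set is covered by the bisections of finitely many group elements. A partition
into finite groupoids therefore gives compact subgroupoids. Conversely, compactness bounds the germs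
at every point, and `IsCore.exists_nhds_localGen` makes the bound locally uniform. -/

theorem act_length (X : BisetBasis G B) (g : G) (v : X.Word) : (X.act g v).length = v.length := by
  induction v generalizing g with
  | nil => rfl
  | cons x v ih => simp [act, ih]

theorem sec_append (X : BisetBasis G B) (g : G) (v w : X.Word) :
    X.sec g (v ++ w) = X.sec (X.sec g v) w := by
  induction v generalizing g with
  | nil => rfl
  | cons x v ih => simp [sec, ih]

/-- The set of all sections of the elements of `F`. -/
def sections (X : BisetBasis G B) (F : Set G) : Set G := {h | ∃ g ∈ F, ∃ v : X.Word, X.sec g v = h}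

theorem subset_sections (X : BisetBasis G B) (F : Set G) : F ⊆ X.sections F :=
  fun g hg => ⟨g, hg, [], rfl⟩

/-- A set of group elements is closed under sections. -/
def SecClosed (X : BisetBasis G B) (F : Set G) : Prop := ∀ g ∈ F, ∀ v : X.Word, X.sec g v ∈ F

theorem secClosed_sections (X : BisetBasis G B) (F : Set G) : X.SecClosed (X.sections F) := by
  rintro _ ⟨g, hg, v, rfl⟩ w
  exact ⟨g, hg, v ++ w, X.sec_append g v w⟩

theorem Absorbs.mono {X : BisetBasis G B} {N M : Set G} (h : X.Absorbs N) (hNM : N ⊆ M) :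
    X.Absorbs M := fun g => (h g).imp fun _ hn v hv => hNM (hn v hv)

theorem Absorbs.exists_of_finite {X : BisetBasis G B} {N F : Set G} (h : X.Absorbs N)
    (hF : F.Finite) : ∃ n : ℕ, ∀ g ∈ F, ∀ v : X.Word, n ≤ v.length → X.sec g v ∈ N := by
  choose n hn using h
  obtain ⟨m, hm⟩ := (hF.image n).bddAbove
  exact ⟨m, fun g hg v hv => hn g v ((hm ⟨g, hg, rfl⟩).trans hv)⟩

/-! ### Comparison of two bases -/

/-- Write `c · x₁ ⊗ ⋯ ⊗ xₙ`, for letters `xᵢ` of the basis `X`, as a word over the basis `Y` times a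
group element; this is the word. -/
noncomputable def transWord (X Y : BisetBasis G B) : G → X.Word → Y.Word
  | _, [] => []
  | c, x :: w => Y.letterAct c (Y.rep x.1) ::
      transWord X Y (Y.letterSec c (Y.rep x.1) * Y.coef x.1) w

/-- Write `c · x₁ ⊗ ⋯ ⊗ xₙ`, for letters `xᵢ` of the basis `X`, as a word over the basis `Y` times a
group element; this is the group element. -/
noncomputable def transCoef (X Y : BisetBasis G B) : G → X.Word → G
  | c, [] => c
  | c, x :: w => transCoef X Y (Y.letterSec c (Y.rep x.1) * Y.coef x.1) w

theorem transWord_length (X Y : BisetBasis G B) (c : G) (w : X.Word) :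
    (transWord X Y c w).length = w.length := by
  induction w generalizing c with
  | nil => rfl
  | cons x w ih => simp [transWord, ih]

theorem transCoef_append (X Y : BisetBasis G B) (c : G) (v w : X.Word) :
    transCoef X Y c (v ++ w) = transCoef X Y (transCoef X Y c v) w := by
  induction v generalizing c with
  | nil => rfl
  | cons x v ih => simp [transCoef, ih]

section SelfSimilar

variable [SMulCommClass G Gᵐᵒᵖ B] [SelfSimilarGroup G B]

instance finite_letter (X : BisetBasis G B) : Finite X.Letter := by
  have := SelfSimilarGroup.finite_orbits (G := G) (B := B)
  refine Finite.of_injective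
    (fun x : X.Letter => (Quotient.mk _ x.1 : MulAction.orbitRel.Quotient Gᵐᵒᵖ B)) ?_
  intro x y h
  have h' : x.1 ∈ MulAction.orbit Gᵐᵒᵖ y.1 := Quotient.exact h
  exact Subtype.ext ((X.exists_unique_mem y.1).unique ⟨x.2, h'⟩
    ⟨y.2, MulAction.mem_orbit_self _⟩)

theorem finite_length_eq (X : BisetBasis G B) (n : ℕ) : {v : X.Word | v.length = n}.Finite :=
  List.finite_length_eq _ n

theorem finite_sections (X : BisetBasis G B) {N F : Set G} (hN : N.Finite) (h : X.Absorbs N)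
    (hF : F.Finite) : (X.sections F).Finite := by
  obtain ⟨n, hn⟩ := h.exists_of_finite hF
  refine (hN.union (Set.Finite.image2 X.sec hF (List.finite_length_lt X.Letter n))).subset ?_
  rintro _ ⟨g, hg, v, rfl⟩
  rcases le_or_gt n v.length with hv | hv
  · exact Or.inl (hn g hg v hv)
  · exact Or.inr ⟨g, hg, v, hv, rfl⟩

theorem sec_inv (X : BisetBasis G B) (g : G) (v : X.Word) :
    X.sec g⁻¹ (X.act g v) = (X.sec g v)⁻¹ := by
  rw [eq_inv_iff_mul_eq_one, ← sec_mul, inv_mul_cancel, sec_one]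

theorem act_inv_act (X : BisetBasis G B) (g : G) (v : X.Word) : X.act g⁻¹ (X.act g v) = v := by
  rw [← act_mul, inv_mul_cancel, act_one]

theorem act_act_inv (X : BisetBasis G B) (g : G) (v : X.Word) : X.act g (X.act g⁻¹ v) = v := by
  rw [← act_mul, mul_inv_cancel, act_one]

/-! ### Section-closed sets and cores -/

theorem SecClosed.mul {X : BisetBasis G B} {F F' : Set G} (h : X.SecClosed F)
    (h' : X.SecClosed F') : X.SecClosed (F * F') := by
  rintro _ ⟨a, ha, b, hb, rfl⟩ v
  rw [sec_mul]
  exact Set.mul_mem_mul (h a ha _) (h' b hb _)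

theorem SecClosed.pow {X : BisetBasis G B} {F : Set G} (h : X.SecClosed F) (n : ℕ) :
    X.SecClosed (F ^ n) := by
  induction n with
  | zero =>
    intro g hg v
    rw [pow_zero, Set.mem_one] at hg ⊢
    rw [hg, sec_one]
  | succ n ih => rw [pow_succ]; exact ih.mul h

/-- A finite symmetric set that contains `1`, is closed under sections and absorbs all
sufficiently deep sections. -/
structure IsCore (X : BisetBasis G B) (N : Set G) : Prop where
  finite : N.Finite
  one_mem : 1 ∈ N
  inv_mem : ∀ g ∈ N, g⁻¹ ∈ N
  secClosed : X.SecClosed N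
  absorbs : X.Absorbs N

/-- Adjoining `1` and all sections keeps the set finite. Adjoining inverses then preserves closure
under sections, because sections of inverses are inverses of sections. -/
theorem exists_isCore (X : BisetBasis G B) (h : ∃ N : Set G, N.Finite ∧ X.Absorbs N) :
    ∃ N, X.IsCore N := by
  obtain ⟨N, hN, hA⟩ := h
  have hf := X.finite_sections hN hA (hN.union (Set.finite_singleton 1))
  have hs := X.secClosed_sections (N ∪ {1})
  refine ⟨X.sections (N ∪ {1}) ∪ (X.sections (N ∪ {1}))⁻¹, hf.union hf.inv,
    Or.inl (X.subset_sections _ (Or.inr rfl)), ?_, ?_,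
    hA.mono fun g hg => Or.inl (X.subset_sections _ (Or.inl hg))⟩
  · rintro g (hg | hg)
    · exact Or.inr (Set.inv_mem_inv.mpr hg)
    · exact Or.inl hg
  · rintro g (hg | hg) v
    · exact Or.inl (hs g hg v)
    · refine Or.inr ?_
      have := hs _ hg (X.act g v)
      rwa [sec_inv] at this

theorem finite_pow {F : Set G} (h : F.Finite) (n : ℕ) : (F ^ n).Finite := by
  induction n with
  | zero => rw [pow_zero]; exact Set.finite_one
  | succ n ih => rw [pow_succ]; exact ih.mul h

/-! ### Independence of contraction of the basis -/

theorem transCoef_mul_left (X Y : BisetBasis G B) (p c : G) (w : X.Word) :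
    transCoef X Y (p * c) w = Y.sec p (transWord X Y c w) * transCoef X Y c w := by
  induction w generalizing p c with
  | nil => rfl
  | cons x w ih =>
    simp only [transCoef, transWord, sec]
    rw [(Y.letter_mul p c _).2, mul_assoc, ih]

/-- The element `g` may be moved through `w` over `X` before the change of basis or together with it
over `Y`; uniqueness of the decomposition over `Y` identifies the results. -/
theorem transCoef_mul_right (X Y : BisetBasis G B) (p g : G) (w : X.Word) :
    transCoef X Y (p * g) w = transCoef X Y p (X.act g w) * X.sec g w := by
  induction w generalizing p g with
  | nil => rfl
  | cons x w ih =>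
    simp only [transCoef, act, sec]
    rw [← ih]
    congr 1
    have key : ∀ (a : G) (z : X.Letter),
        MulOpposite.op (Y.letterSec a (Y.rep z.1) * Y.coef z.1) •
          (Y.letterAct a (Y.rep z.1)).1 = a • z.1 := by
      intro a z
      rw [MulOpposite.op_mul, mul_smul, letter_spec, ← smul_comm a, rep_coef]
    refine (Y.decomp_unique (x := Y.letterAct (p * g) (Y.rep x.1))
      (y := Y.letterAct p (Y.rep (X.letterAct g x).1)) ?_).2
    rw [key, MulOpposite.op_mul, mul_smul, mul_smul, key, ← X.letter_spec g x, smul_comm p]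

/-- Sections over the two bases differ by the change-of-basis coefficients of a word and of its
image. The point is that these coefficients range over a finite set. -/
theorem exists_absorbs_of_isContracting (hG : IsContracting G B) (X : BisetBasis G B) :
    ∃ N : Set G, N.Finite ∧ X.Absorbs N := by
  obtain ⟨Y, N, hN, hA⟩ := hG
  set F : Set G := N ∪ {1} ∪ Set.range (fun x : X.Letter => Y.coef x.1) with hFdef
  have hF : F.Finite := (hN.union (Set.finite_singleton 1)).union (Set.finite_range _)
  set S := Y.sections F
  have hS : S.Finite := Y.finite_sections hN hA hF
  have hSc : Y.SecClosed S := Y.secClosed_sections F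
  have hNS : N ⊆ S := fun g hg => Y.subset_sections _ (Or.inl (Or.inl hg))
  have h1S : (1 : G) ∈ S := Y.subset_sections _ (Or.inl (Or.inr rfl))
  have hXS : ∀ x : X.Letter, Y.coef x.1 ∈ S := fun x => Y.subset_sections _ (Or.inr ⟨x, rfl⟩)
  obtain ⟨n, h0, hn⟩ : ∃ n, 0 < n ∧ ∀ g ∈ S ^ 2, ∀ v : Y.Word, n ≤ v.length → Y.sec g v ∈ N := by
    obtain ⟨n, hn⟩ := hA.exists_of_finite (finite_pow hS 2)
    exact ⟨n + 1, n.succ_pos, fun g hg v hv => hn g hg v (n.le_succ.trans hv)⟩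
  -- Deep sections halve the length of a product: each factor from `S ^ 2` becomes an element of `N
  -- ⊆ S`.
  have hhalf : ∀ (k : ℕ) (c : G), c ∈ (S ^ 2) ^ k → ∀ v : Y.Word, n ≤ v.length →
      Y.sec c v ∈ S ^ k := by
    intro k
    induction k with
    | zero =>
      intro c hc v _
      rw [pow_zero, Set.mem_one] at hc ⊢
      rw [hc, sec_one]
    | succ k ih =>
      intro c hc v hv
      rw [pow_succ] at hc ⊢
      obtain ⟨a, ha, b, hb, rfl⟩ := hc
      rw [sec_mul]
      exact Set.mul_mem_mul (ih a ha _ (by rwa [act_length])) (hNS (hn b hb v hv))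
  have hgrow : ∀ (w : X.Word) (j : ℕ) (c : G), c ∈ S ^ j →
      transCoef X Y c w ∈ S ^ (j + w.length) := by
    intro w
    induction w with
    | nil => intro j c hc; exact hc
    | cons x w ih =>
      intro j c hc
      have h2 : Y.letterSec c (Y.rep x.1) * Y.coef x.1 ∈ S ^ (j + 1) := by
        rw [pow_succ]
        exact Set.mul_mem_mul (hSc.pow j c hc [Y.rep x.1]) (hXS x)
      have := ih (j + 1) _ h2
      rwa [List.length_cons, show j + (w.length + 1) = j + 1 + w.length by omega]
  -- Read `w` in blocks of `n` letters. Over a block the carried element shrinks from `S ^ (2 * n)`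
  -- to `S ^ n` and gains at most `n` factors, so it returns to `S ^ (2 * n)`. The last incomplete
  -- block adds at most `n` more; the extra `1` is slack.
  have hbound : ∀ (l : ℕ) (w : X.Word), w.length ≤ l → ∀ c ∈ S ^ (2 * n),
      transCoef X Y c w ∈ S ^ (3 * n + 1) := by
    intro l
    induction l with
    | zero =>
      intro w hw c hc
      exact Set.pow_subset_pow_right h1S (by omega) (hgrow w _ c hc)
    | succ l ih =>
      intro w hw c hc
      rcases le_or_gt w.length n with h | h
      · exact Set.pow_subset_pow_right h1S (by omega) (hgrow w _ c hc)
      · have hlen : (w.take n).length = n := by simp; omega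
        rw [← List.take_append_drop n w, transCoef_append]
        refine ih _ (by rw [List.length_drop]; omega) _ ?_
        rw [← mul_one c, transCoef_mul_left, two_mul, pow_add]
        refine Set.mul_mem_mul (hhalf n c (by rwa [← pow_mul]) _ ?_) ?_
        · rw [transWord_length, hlen]
        · have := hgrow (w.take n) 0 1 (by simp)
          rwa [hlen, zero_add] at this
  have hM : ∀ w : X.Word, transCoef X Y 1 w ∈ S ^ (3 * n + 1) := fun w =>
    hbound _ w le_rfl 1 (Set.one_mem_pow h1S)
  have hMf : (S ^ (3 * n + 1)).Finite := finite_pow hS _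
  refine ⟨(S ^ (3 * n + 1))⁻¹ * (N * S ^ (3 * n + 1)), hMf.inv.mul (hN.mul hMf), fun g => ?_⟩
  obtain ⟨m, hm⟩ := hA g
  refine ⟨m, fun w hw => ?_⟩
  have h1 := transCoef_mul_right X Y 1 g w
  rw [one_mul, ← mul_one g, transCoef_mul_left, mul_one] at h1
  have h2 : X.sec g w = (transCoef X Y 1 (X.act g w))⁻¹ *
      (Y.sec g (transWord X Y 1 w) * transCoef X Y 1 w) := by
    rw [h1, inv_mul_cancel_left]
  rw [h2]
  exact Set.mul_mem_mul (Set.inv_mem_inv.mpr (hM _))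
    (Set.mul_mem_mul (hm _ (by rwa [transWord_length])) (hM _))

end SelfSimilar

end BisetBasis

namespace BisetBasis

variable {G : Type u} {B : Type v} [Group G] [MulAction G B] [MulAction Gᵐᵒᵖ B]

/-! ### Paths of generators and finiteness of the generated groupoid -/

theorem act_take (X : BisetBasis G B) (g : G) (m : ℕ) (w : X.Word) :
    (X.act g w).take m = X.act g (w.take m) := by
  induction w generalizing g m with
  | nil => simp [act]
  | cons x w ih => cases m <;> simp [act, ih]

theorem act_drop (X : BisetBasis G B) (g : G) (m : ℕ) (w : X.Word) :
    (X.act g w).drop m = X.act (X.sec g (w.take m)) (w.drop m) := by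
  induction w generalizing g m with
  | nil => simp [act]
  | cons x w ih => cases m <;> simp [act, sec, ih]

theorem sec_take_drop (X : BisetBasis G B) (g : G) (m : ℕ) (w : X.Word) :
    X.sec g w = X.sec (X.sec g (w.take m)) (w.drop m) := by
  rw [← sec_append, List.take_append_drop]

/-- The products `aₖ ⋯ a₁` of elements of `A` and their inverses for which all the words
`aⱼ ⋯ a₁(v)` belong to `V`. -/
inductive LocalGen (X : BisetBasis G B) (A : Set G) (V : Set X.Word) (v : X.Word) : G → Prop
  | one (hv : v ∈ V) : LocalGen X A V v 1
  | step {g a : G} (h : LocalGen X A V v g) (ha : a ∈ A ∨ a⁻¹ ∈ A) (hV : X.act (a * g) v ∈ V) :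
      LocalGen X A V v (a * g)

variable {X : BisetBasis G B} {A : Set G} {V : Set X.Word} {v : X.Word} {g h : G}

theorem LocalGen.source_mem (hg : X.LocalGen A V v g) : v ∈ V := by
  induction hg with
  | one hv => exact hv
  | step _ _ _ ih => exact ih

theorem LocalGen.of (hv : v ∈ V) (hg : g ∈ A ∨ g⁻¹ ∈ A) (hgv : X.act g v ∈ V) :
    X.LocalGen A V v g := by
  have := (LocalGen.one (X := X) (A := A) hv).step hg (by rwa [mul_one])
  rwa [mul_one] at this

section SelfSimilar

variable [SMulCommClass G Gᵐᵒᵖ B] [SelfSimilarGroup G B]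

theorem LocalGen.target_mem (hg : X.LocalGen A V v g) : X.act g v ∈ V := by
  cases hg with
  | one hv => rwa [act_one]
  | step _ _ hV => exact hV

theorem LocalGen.mul (hg : X.LocalGen A V v g) (hh : X.LocalGen A V (X.act g v) h) :
    X.LocalGen A V v (h * g) := by
  induction hh with
  | one _ => rwa [one_mul]
  | step _ ha hV ih =>
    rw [mul_assoc]
    exact ih.step ha (by rwa [← mul_assoc, act_mul])

theorem LocalGen.inv (hg : X.LocalGen A V v g) : X.LocalGen A V (X.act g v) g⁻¹ := by
  induction hg with
  | one hv => rw [inv_one, act_one]; exact .one hv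
  | @step g a hg ha hV ih =>
    have hback : X.act a⁻¹ (X.act (a * g) v) = X.act g v := by rw [act_mul, act_inv_act]
    rw [mul_inv_rev]
    refine LocalGen.mul (LocalGen.of hV ?_ ?_) ?_
    · rw [inv_inv]; exact ha.symm
    · rw [hback]; exact hg.target_mem
    · rwa [hback]

theorem GeneratedIso.exists_localGen {w : X.Word} {φ : X.Subtree v ≃ X.Subtree w}
    (h : X.GeneratedIso A V v w φ) :
    ∃ g, X.LocalGen A V v g ∧ X.act g v = w ∧ ∀ u, (φ u).1 = X.act g u.1 := by
  induction h with
  | of g v hg hv hgv => exact ⟨g, .of hv (Or.inl hg) hgv, rfl, fun u => rfl⟩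
  | refl v hv => exact ⟨1, .one hv, X.act_one v, fun u => (X.act_one u.1).symm⟩
  | @symm v w φ _ ih =>
    obtain ⟨g, hg, rfl, hφ⟩ := ih
    refine ⟨g⁻¹, hg.inv, X.act_inv_act g v, fun u => ?_⟩
    have := hφ (φ.symm u)
    rw [Equiv.apply_symm_apply] at this
    rw [this, act_inv_act]
  | trans _ _ ih ih' =>
    obtain ⟨g, hg, rfl, hφ⟩ := ih
    obtain ⟨h, hh, rfl, hψ⟩ := ih'
    refine ⟨h * g, hg.mul hh, X.act_mul h g _, fun u => ?_⟩
    rw [Equiv.trans_apply, hψ, hφ, act_mul]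

/-- Quantifying over every isomorphism that acts as `g` avoids transport along equalities of target
words. -/
theorem LocalGen.generatedIso (h : X.LocalGen A V v g) :
    ∀ (w : X.Word) (φ : X.Subtree v ≃ X.Subtree w), X.act g v = w →
      (∀ u, (φ u).1 = X.act g u.1) → X.GeneratedIso A V v w φ := by
  induction h with
  | one hv =>
    intro w φ hw hφ
    rw [act_one] at hw
    subst hw
    have : φ = Equiv.refl _ := Equiv.ext fun u => Subtype.ext (by rw [hφ, act_one]; rfl)
    rw [this]
    exact .refl v hv
  | @step g a hg ha hV ih =>
    intro w φ hw hφ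
    rw [act_mul] at hw
    have h1 := ih _ (X.restrictIso g v) rfl fun u => rfl
    have h2 : X.GeneratedIso A V (X.act g v) w ((X.restrictIso g v).symm.trans φ) := by
      have hval : ∀ u, (((X.restrictIso g v).symm.trans φ) u).1 = X.act a u.1 := by
        intro u
        obtain ⟨u, rfl⟩ := (X.restrictIso g v).surjective u
        rw [Equiv.trans_apply, Equiv.symm_apply_apply, hφ, act_mul]
        rfl
      rcases ha with ha | ha
      · subst hw
        have := GeneratedIso.of (X := X) a (X.act g v) ha hg.target_mem
          (by rwa [act_mul] at hV)
        convert this using 1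
        exact Equiv.ext fun u => Subtype.ext (hval u)
      -- Here only `a⁻¹` is a generator, so the last step is the inverse of its restriction. The
      -- middle word is generalized in order to substitute it.
      · have hw' : X.act a⁻¹ w = X.act g v := by rw [← hw, act_inv_act]
        have hwV : w ∈ V := by rwa [act_mul, hw] at hV
        generalize (X.restrictIso g v).symm.trans φ = ψ at hval
        have hgV := hg.target_mem
        clear ih h1 hw
        generalize X.act g v = z at *
        subst hw'
        have := (GeneratedIso.of (X := X) a⁻¹ w ha hwV hgV).symm
        convert this using 1
        refine Equiv.ext fun u => Subtype.ext ?_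
        obtain ⟨u, rfl⟩ := (X.restrictIso a⁻¹ w).surjective u
        rw [hval, Equiv.symm_apply_apply]
        exact X.act_act_inv a u.1
    have := h1.trans h2
    rwa [← Equiv.trans_assoc, Equiv.self_trans_symm, Equiv.refl_trans] at this

/-- The representatives are themselves local products, as is needed to keep their germs inside the
subgroupoid `localGroupoid`. -/
theorem FiniteGroupoid.exists_localGen (h : X.FiniteGroupoid A V) :
    ∃ Q : Set G, Q.Finite ∧ ∀ v g, X.LocalGen A V v g →
      ∃ q ∈ Q, X.LocalGen A V v q ∧ ∀ u, v <+: u → X.act g u = X.act q u := by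
  have hex : ∀ γ : {γ : Σ v w : X.Word, X.Subtree v ≃ X.Subtree w |
      X.GeneratedIso A V γ.1 γ.2.1 γ.2.2}, ∃ q, X.LocalGen A V γ.1.1 q ∧
        X.act q γ.1.1 = γ.1.2.1 ∧ ∀ u, (γ.1.2.2 u).1 = X.act q u.1 := fun γ =>
    GeneratedIso.exists_localGen γ.2
  choose q hq using hex
  have : Finite {γ : Σ v w : X.Word, X.Subtree v ≃ X.Subtree w |
      X.GeneratedIso A V γ.1 γ.2.1 γ.2.2} := h
  refine ⟨Set.range q, Set.finite_range q, fun v g hg => ?_⟩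
  have hm := hg.generatedIso _ (X.restrictIso g v) rfl fun u => rfl
  refine ⟨_, ⟨⟨⟨v, _, X.restrictIso g v⟩, hm⟩, rfl⟩, (hq ⟨⟨v, _, X.restrictIso g v⟩, hm⟩).1,
    fun u hu => ?_⟩
  exact (hq ⟨⟨v, _, X.restrictIso g v⟩, hm⟩).2.2 ⟨u, hu⟩

theorem finiteGroupoid_iff (hV : V.Finite) :
    X.FiniteGroupoid A V ↔ ∃ Q : Set G, Q.Finite ∧ ∀ v g, X.LocalGen A V v g →
      ∃ q ∈ Q, ∀ t, X.act (X.sec g v) t = X.act q t := by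
  constructor
  · intro h
    obtain ⟨Q, hQ, hQ'⟩ := h.exists_localGen
    refine ⟨Set.image2 X.sec Q V, Set.Finite.image2 _ hQ hV, fun v g hg => ?_⟩
    obtain ⟨q, hq, -, hqv⟩ := hQ' v g hg
    refine ⟨_, ⟨q, hq, v, hg.source_mem, rfl⟩, fun t => ?_⟩
    have := hqv (v ++ t) ⟨t, rfl⟩
    rw [act_append, act_append] at this
    exact (List.append_inj this (by rw [act_length, act_length])).2
  · rintro ⟨Q, hQ, hQ'⟩
    have hex : ∀ γ : {γ : Σ v w : X.Word, X.Subtree v ≃ X.Subtree w |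
        X.GeneratedIso A V γ.1 γ.2.1 γ.2.2}, ∃ q ∈ Q, γ.1.1 ∈ V ∧ γ.1.2.1 ∈ V ∧
          ∀ t (h : γ.1.1 <+: γ.1.1 ++ t), (γ.1.2.2 ⟨γ.1.1 ++ t, h⟩).1 = γ.1.2.1 ++ X.act q t := by
      rintro ⟨⟨v, w, φ⟩, h⟩
      obtain ⟨g, hg, hgv, hφ⟩ := GeneratedIso.exists_localGen h
      obtain ⟨q, hq, hqg⟩ := hQ' v g hg
      refine ⟨q, hq, hg.source_mem, hgv ▸ hg.target_mem, fun t ht => ?_⟩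
      refine (hφ _).trans ?_
      rw [act_append, hgv, hqg]
    choose q hq using hex
    have hfin : (V ×ˢ V ×ˢ Q).Finite := hV.prod (hV.prod hQ)
    have : Finite ↥(V ×ˢ V ×ˢ Q) := hfin
    -- A generated isomorphism is determined by its source, its target and an element that describes
    -- it on the tails.
    refine Finite.of_injective (fun γ => (⟨(γ.1.1, γ.1.2.1, q γ),
      (hq γ).2.1, (hq γ).2.2.1, (hq γ).1⟩ : ↥(V ×ˢ V ×ˢ Q))) fun γ γ' he => ?_
    have he' := congrArg Subtype.val he
    simp only [Prod.mk.injEq] at he'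
    have h1 := (hq γ).2.2.2
    have h2 := (hq γ').2.2.2
    obtain ⟨e1, e2, e3⟩ := he'
    rw [← e3] at h2
    generalize q γ = r at h1 h2
    obtain ⟨⟨v, w, φ⟩, h⟩ := γ
    obtain ⟨⟨v', w', φ'⟩, h'⟩ := γ'
    dsimp only at e1 e2 h1 h2
    subst e1 e2
    refine Subtype.ext ?_
    have : φ = φ' := by
      refine Equiv.ext ?_
      rintro ⟨_, t, rfl⟩
      exact Subtype.ext ((h1 t _).trans (h2 t _).symm)
    subst this
    rfl

/-- Words `uv`, with `u` of length `m` and `v` in `V`. -/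
def prefixExt (X : BisetBasis G B) (m : ℕ) (V : Set X.Word) : Set X.Word :=
  {w | m ≤ w.length ∧ w.drop m ∈ V}

/-- Taking the section of every step of a path at the current first `m` letters gives a path of the
remaining suffixes, with steps in `N` up to inversion. -/
theorem LocalGen.sec_take {N : Set G} {m : ℕ} {w : X.Word}
    (hA : ∀ a ∈ A, ∀ u : X.Word, m ≤ u.length → X.sec a u ∈ N)
    (hg : X.LocalGen A (X.prefixExt m V) w g) :
    X.LocalGen N V (w.drop m) (X.sec g (w.take m)) := by
  have hw := hg.source_mem
  have hlen : (w.take m).length = m := by rw [List.length_take]; exact min_eq_left hw.1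
  induction hg with
  | one h => rw [sec_one]; exact .one h.2
  | @step g a hg ha hV ih =>
    rw [sec_mul]
    refine ih.step ?_ ?_
    · rcases ha with ha | ha
      · exact Or.inl (hA a ha _ (by rw [act_length, hlen]))
      · refine Or.inr ?_
        rw [← sec_inv]
        exact hA _ ha _ (by rw [act_length, act_length, hlen])
    · have := hV.2
      rwa [act_drop, sec_mul] at this

theorem HasFinitePartition.of_absorbs {N : Set G} {d : ℕ} (hN : X.Absorbs N)
    (h : X.HasFinitePartition N d) (hA : A.Finite) : X.HasFinitePartition A d := by
  obtain ⟨n, hn, V, hV, hdisj, hfin⟩ := h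
  obtain ⟨m, hm⟩ := hN.exists_of_finite hA
  have hVn : ∀ i, ∀ v ∈ V i, v.length = n := fun i v hv => by
    have : v ∈ ⋃ i, V i := Set.mem_iUnion.mpr ⟨i, hv⟩
    rwa [hV] at this
  have hVfin : ∀ i, (V i).Finite := fun i => (X.finite_length_eq n).subset (hVn i)
  have hlen : ∀ i, ∀ w ∈ X.prefixExt m (V i), w.length = m + n := by
    intro i w hw
    have := hVn i _ hw.2
    rw [List.length_drop] at this
    have := hw.1
    omega
  refine ⟨m + n, by omega, fun i => X.prefixExt m (V i), ?_, ?_, fun i => ?_⟩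
  · ext w
    simp only [Set.mem_iUnion, Set.mem_ofPred_eq]
    constructor
    · rintro ⟨i, hw⟩
      exact hlen i w hw
    · intro hw
      have : w.drop m ∈ ⋃ i, V i := by
        rw [hV, Set.mem_ofPred_eq, List.length_drop]
        omega
      obtain ⟨i, hi⟩ := Set.mem_iUnion.mp this
      exact ⟨i, by omega, hi⟩
  · intro i j hij
    exact Set.disjoint_left.mpr fun w hw hw' => Set.disjoint_left.mp (hdisj hij) hw.2 hw'.2
  · obtain ⟨Q, hQ, hQ'⟩ := (finiteGroupoid_iff (hVfin i)).mp (hfin i)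
    refine (finiteGroupoid_iff ((X.finite_length_eq (m + n)).subset (hlen i))).mpr
      ⟨Q, hQ, fun w g hg => ?_⟩
    rw [X.sec_take_drop g m w]
    exact hQ' _ _ (hg.sec_take hm)

end SelfSimilar

end BisetBasis

namespace BisetBasis

variable {G : Type u} {B : Type v} [Group G] [MulAction G B] [MulAction Gᵐᵒᵖ B]

/-! ### Left-infinite sequences and the limit space -/

section Trunc

variable {G : Type u} {B : Type v} [Group G] [MulAction Gᵐᵒᵖ B]

theorem LeftSeq.trunc_length {X : BisetBasis G B} (x : X.LeftSeq) (n : ℕ) :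
    (x.trunc n).length = n := by
  induction n with
  | zero => rfl
  | succ n ih => simp [LeftSeq.trunc, ih]

theorem LeftSeq.trunc_drop {X : BisetBasis G B} (x : X.LeftSeq) (k n : ℕ) :
    (x.trunc (k + n)).drop k = x.trunc n := by
  induction k with
  | zero => simp
  | succ k ih => rw [Nat.succ_add, LeftSeq.trunc, List.drop_succ_cons, ih]

theorem exists_trunc_eq {X : BisetBasis G B} [Nonempty X.Letter] (v : X.Word) :
    ∃ x : X.LeftSeq, x.trunc v.length = v := by
  induction v with
  | nil => exact ⟨fun _ => Classical.arbitrary _, rfl⟩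
  | cons a v ih =>
    obtain ⟨x, hx⟩ := ih
    refine ⟨fun k => if k = v.length then a else x k, ?_⟩
    have : ∀ n, n ≤ v.length →
        LeftSeq.trunc (fun k => if k = v.length then a else x k : X.LeftSeq) n = x.trunc n := by
      intro n
      induction n with
      | zero => intro _; rfl
      | succ n ih =>
        intro hn
        simp only [LeftSeq.trunc]
        rw [ih (by omega), if_neg (by omega)]
    have h' := this _ le_rfl
    rw [hx] at h'
    change (if v.length = v.length then a else x v.length) :: LeftSeq.trunc _ v.length = a :: v
    rw [h', if_pos rfl]

end Trunc

theorem act_sec_trunc {X : BisetBasis G B} {x y : X.LeftSeq} {a : G} {k n : ℕ}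
    (h : X.act a (x.trunc (k + n)) = y.trunc (k + n)) :
    X.act (X.sec a ((x.trunc (k + n)).take k)) (x.trunc n) = y.trunc n := by
  have := X.act_drop a k (x.trunc (k + n))
  rwa [h, LeftSeq.trunc_drop, LeftSeq.trunc_drop, eq_comm] at this

/-- Compare the sequences `k` letters further to the left and take the section there; for large `k`
it falls into `N`. -/
theorem IsCore.trunc_of_finite {X : BisetBasis G B} {N : Set G} (hN : X.IsCore N)
    {F : Set G} (hF : F.Finite) {x y : X.LeftSeq}
    (h : ∀ n, ∃ a ∈ F, X.act a (x.trunc n) = y.trunc n) (n : ℕ) :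
    ∃ a ∈ N, X.act a (x.trunc n) = y.trunc n := by
  obtain ⟨k, hk⟩ := hN.absorbs.exists_of_finite hF
  obtain ⟨a, ha, hxy⟩ := h (k + n)
  refine ⟨_, hk a ha ((x.trunc (k + n)).take k) ?_, act_sec_trunc hxy⟩
  rw [List.length_take, LeftSeq.trunc_length]
  omega

section SelfSimilar

variable [SMulCommClass G Gᵐᵒᵖ B] [SelfSimilarGroup G B]

instance (X : BisetBasis G B) : CompactSpace X.LeftSeq :=
  inferInstanceAs (CompactSpace (ℕ → X.Letter))

theorem isClopen_trunc (X : BisetBasis G B) (n : ℕ) (P : Set X.Word) :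
    IsClopen {x : X.LeftSeq | x.trunc n ∈ P} := by
  induction n generalizing P with
  | zero =>
    by_cases h : [] ∈ P
    · convert isClopen_univ
      exact Set.eq_univ_of_forall fun _ => h
    · convert isClopen_empty
      exact Set.eq_empty_of_forall_notMem fun _ => h
  | succ n ih =>
    have : {x : X.LeftSeq | x.trunc (n + 1) ∈ P} =
        ⋃ a : X.Letter, {x : X.LeftSeq | x n = a} ∩ {x | x.trunc n ∈ {w | a :: w ∈ P}} := by
      ext x
      rw [Set.mem_iUnion]
      exact ⟨fun h => ⟨x n, rfl, h⟩, fun ⟨a, ha, h⟩ => by subst ha; exact h⟩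
    rw [this]
    refine isClopen_iUnion_of_finite fun a => IsClopen.inter ?_ (ih _)
    exact (isClopen_discrete {a}).preimage (continuous_apply (A := fun _ : ℕ => X.Letter) n)

theorem isClopen_trunc_prod (X : BisetBasis G B) (n : ℕ) (r : X.Word → X.Word → Prop) :
    IsClopen {p : X.LeftSeq × X.LeftSeq | r (p.1.trunc n) (p.2.trunc n)} := by
  have : {p : X.LeftSeq × X.LeftSeq | r (p.1.trunc n) (p.2.trunc n)} =
      ⋃ w ∈ {w : X.Word | w.length = n}, Prod.fst ⁻¹' {x : X.LeftSeq | x.trunc n ∈ ({w} : Set X.Word)} ∩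
        Prod.snd ⁻¹' {x : X.LeftSeq | x.trunc n ∈ {u | r w u}} := by
    ext p
    simp [LeftSeq.trunc_length]
  rw [this]
  exact (X.finite_length_eq n).isClopen_biUnion fun w _ =>
    ((X.isClopen_trunc n _).preimage continuous_fst).inter
      ((X.isClopen_trunc n _).preimage continuous_snd)

/-- The point of the limit space represented by a left-infinite sequence. -/
def proj (X : BisetBasis G B) (x : X.LeftSeq) : X.LimitSpace :=
  Quotient.mk _ (Quotient.mk X.asympSetoid (x, 1))

theorem proj_surjective (X : BisetBasis G B) : Function.Surjective X.proj := by
  rintro ⟨⟨x, g⟩⟩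
  refine ⟨x, Quotient.sound ⟨MulOpposite.op g⁻¹, ?_⟩⟩
  exact congrArg (Quotient.mk X.asympSetoid) (Prod.ext rfl (mul_inv_cancel g))

theorem isOpen_iff_proj (X : BisetBasis G B) {U : Set X.LimitSpace} :
    IsOpen U ↔ IsOpen (X.proj ⁻¹' U) := by
  let _ : TopologicalSpace G := ⊥
  have : DiscreteTopology G := ⟨rfl⟩
  have h1 : IsOpen U ↔ IsOpen {p : X.LeftSeq × G |
      (Quotient.mk _ (Quotient.mk X.asympSetoid p) : X.LimitSpace) ∈ U} := Iff.rfl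
  have h2 : {p : X.LeftSeq × G |
      (Quotient.mk _ (Quotient.mk X.asympSetoid p) : X.LimitSpace) ∈ U} =
      Prod.fst ⁻¹' (X.proj ⁻¹' U) := by
    ext ⟨x, g⟩
    have : (Quotient.mk _ (Quotient.mk X.asympSetoid (x, g)) : X.LimitSpace) = X.proj x := by
      refine Quotient.sound ⟨MulOpposite.op g, ?_⟩
      exact congrArg (Quotient.mk X.asympSetoid) (Prod.ext rfl (one_mul g))
    change _ ∈ U ↔ _ ∈ U
    rw [this]
  rw [h1, h2]
  constructor
  · intro h
    exact h.preimage (f := fun x : X.LeftSeq => (x, (1 : G))) (Continuous.prodMk_left 1)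
  · intro h
    exact h.preimage continuous_fst

theorem continuous_proj (X : BisetBasis G B) : Continuous X.proj :=
  ⟨fun _ h => X.isOpen_iff_proj.mp h⟩

instance (X : BisetBasis G B) : CompactSpace X.LimitSpace :=
  X.proj_surjective.compactSpace X.continuous_proj

/-! ### Fibres of the projection, star sets and tiles -/

variable {X : BisetBasis G B} {N : Set G}

/-- A decreasing sequence of nonempty subsets of a finite set has nonempty intersection. -/
theorem exists_forall_mem_of_antitone {α : Type*} {F : Set α} (hF : F.Finite) {S : ℕ → Set α}
    (hS : Antitone S) (hSF : ∀ n, (F ∩ S n).Nonempty) : ∃ g ∈ F, ∀ n, g ∈ S n := by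
  by_contra! h
  choose! n hn using h
  obtain ⟨m, hm⟩ := (hF.image n).bddAbove
  obtain ⟨g, hg, hgm⟩ := hSF m
  exact hn g hg (hS (hm ⟨g, hg, rfl⟩) hgm)

theorem IsCore.proj_eq_iff (hN : X.IsCore N) {x y : X.LeftSeq} :
    X.proj x = X.proj y ↔ ∀ n, ∃ a ∈ N, X.act a (x.trunc n) = y.trunc n := by
  constructor
  · intro h
    obtain ⟨g, hg⟩ := Quotient.exact h.symm
    obtain ⟨F, hF, a, ha, e⟩ := Quotient.exact hg
    exact hN.trunc_of_finite hF fun n => ⟨a n, ha n, (e n).1⟩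
  · intro h
    have hanti : Antitone fun n : ℕ =>
        {g | ∃ a ∈ N, X.act a (x.trunc n) = y.trunc n ∧ X.sec a (x.trunc n) = g} := by
      refine antitone_nat_of_succ_le ?_
      rintro n _ ⟨a, ha, hxy, rfl⟩
      exact ⟨X.sec a [x n], hN.secClosed a ha _, (List.cons.inj hxy).2, rfl⟩
    -- Equality in the limit `G`-space requires the same final section on all levels. The candidates
    -- on level `n` decrease with `n` inside the finite set `N`, so one survives.
    obtain ⟨g, -, hg⟩ := exists_forall_mem_of_antitone hN.finite hanti fun n => by
      obtain ⟨a, ha, hxy⟩ := h n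
      exact ⟨_, hN.secClosed a ha _, a, ha, hxy, rfl⟩
    choose a ha hxy hag using hg
    refine (Quotient.sound ⟨MulOpposite.op g⁻¹, Quotient.sound (s := X.asympSetoid)
      ⟨N, hN.finite, a, ha, fun n => ⟨hxy n, ?_⟩⟩⟩ : X.proj y = X.proj x).symm
    change X.sec (a n) (x.trunc n) * (1 * g⁻¹) = 1
    rw [hag, one_mul, mul_inv_cancel]

/-- The equivalence relation is an intersection of clopen conditions, so the saturation of a
cylinder set is the projection of a closed set along a compact factor. -/
theorem IsCore.isClosed_proj_image (hN : X.IsCore N) (n : ℕ) (P : Set X.Word) :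
    IsClosed (X.proj '' {z | z.trunc n ∈ P}) := by
  have hR : IsClosed {p : X.LeftSeq × X.LeftSeq | X.proj p.1 = X.proj p.2} := by
    have : {p : X.LeftSeq × X.LeftSeq | X.proj p.1 = X.proj p.2} =
        ⋂ n, {p | ∃ a ∈ N, X.act a (p.1.trunc n) = p.2.trunc n} := by
      ext p
      rw [Set.mem_iInter]
      exact hN.proj_eq_iff
    rw [this]
    exact isClosed_iInter fun n => (X.isClopen_trunc_prod n fun u w => ∃ a ∈ N, X.act a u = w).1
  rw [← isOpen_compl_iff, isOpen_iff_proj, Set.preimage_compl, isOpen_compl_iff]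
  have : X.proj ⁻¹' (X.proj '' {z | z.trunc n ∈ P}) =
      Prod.snd '' ({p : X.LeftSeq × X.LeftSeq | X.proj p.1 = X.proj p.2} ∩
        Prod.fst ⁻¹' {z | z.trunc n ∈ P}) := by
    ext y
    constructor
    · rintro ⟨x, hx, hxy⟩
      exact ⟨(x, y), ⟨hxy, hx⟩, rfl⟩
    · rintro ⟨⟨x, y⟩, ⟨hxy, hx⟩, rfl⟩
      exact ⟨x, hx, hxy⟩
  rw [this]
  exact isClosedMap_snd_of_compactSpace _
    (hR.inter ((X.isClopen_trunc n P).1.preimage continuous_fst))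

/-- The points of the limit space all of whose representatives end with a word in `P`. -/
def starSet (X : BisetBasis G B) (n : ℕ) (P : Set X.Word) : Set X.LimitSpace :=
  {q | ∀ z, X.proj z = q → z.trunc n ∈ P}

theorem IsCore.isOpen_starSet (hN : X.IsCore N) (n : ℕ) (P : Set X.Word) :
    IsOpen (X.starSet n P) := by
  have : X.starSet n P = (X.proj '' {z | z.trunc n ∈ Pᶜ})ᶜ := by
    ext q
    simp only [starSet, Set.mem_compl_iff, Set.mem_image]
    exact ⟨fun h ⟨z, hz, e⟩ => hz (h z e), fun h z e => by_contra fun hz => h ⟨z, hz, e⟩⟩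
  rw [this]
  exact (hN.isClosed_proj_image n _).isOpen_compl

/-- The tile of points represented by sequences ending with the word `v`. -/
def tile (X : BisetBasis G B) (v : X.Word) : Set X.LimitSpace :=
  X.proj '' {z | z.trunc v.length = v}

theorem proj_mem_tile (X : BisetBasis G B) (z : X.LeftSeq) (n : ℕ) :
    X.proj z ∈ X.tile (z.trunc n) := ⟨z, by simp [LeftSeq.trunc_length], rfl⟩

/-- Small tiles, together with their images under a finite set, are subordinate to a given open
cover of the limit space. -/
theorem IsCore.exists_lebesgue (hN : X.IsCore N) {𝒰 : Set (Set X.LimitSpace)}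
    (hU : ∀ U ∈ 𝒰, IsOpen U) (hcov : ⋃₀ 𝒰 = Set.univ) {F : Set G} (hF : F.Finite) :
    ∃ m₀ : ℕ, 1 ≤ m₀ ∧ ∀ v : X.Word, m₀ ≤ v.length →
      ∃ U ∈ 𝒰, ∀ f ∈ F, X.tile (X.act f v) ⊆ U := by
  have hF' := X.finite_sections hN.finite hN.absorbs hF
  have hloc : ∀ x : X.LeftSeq, ∃ m : ℕ, ∃ U ∈ 𝒰, ∀ f ∈ X.sections F, ∀ z : X.LeftSeq,
      z.trunc m = X.act f (x.trunc m) → X.proj z ∈ U := by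
    intro x
    obtain ⟨U, hU𝒰, hxU⟩ : ∃ U ∈ 𝒰, X.proj x ∈ U := by
      rw [← Set.mem_sUnion, hcov]; trivial
    -- Otherwise compactness gives a point `z` outside the preimage of `U` whose truncations are all
    -- images of those of `x` under the finite set of sections. Then `z` and `x` represent the same
    -- point.
    by_contra! hcon
    have hclosed : ∀ m, IsClosed ({z : X.LeftSeq |
        ∃ f ∈ X.sections F, X.act f (x.trunc m) = z.trunc m} ∩ (X.proj ⁻¹' U)ᶜ) := fun m =>
      (X.isClopen_trunc m {w | ∃ f ∈ X.sections F, X.act f (x.trunc m) = w}).1.inter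
        ((hU U hU𝒰).preimage X.continuous_proj).isClosed_compl
    have hne := IsCompact.nonempty_iInter_of_sequence_nonempty_isCompact_isClosed _
      (fun m => by
        rintro z ⟨⟨f, hf, hz⟩, hzU⟩
        exact ⟨⟨_, X.secClosed_sections F f hf [x m], (List.cons.inj hz).2⟩, hzU⟩)
      (fun m => by
        obtain ⟨f, hf, z, hz, hzU⟩ := hcon m U hU𝒰
        exact ⟨z, ⟨f, hf, hz.symm⟩, hzU⟩) (hclosed 0).isCompact hclosed
    obtain ⟨z, hz⟩ := hne
    rw [Set.mem_iInter] at hz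
    have : X.proj x = X.proj z :=
      hN.proj_eq_iff.mpr (hN.trunc_of_finite hF' fun n => (hz n).1)
    refine (hz 0).2 ?_
    rw [Set.mem_preimage, ← this]
    exact hxU
  choose m U hU𝒰 hmU using hloc
  obtain ⟨t, ht⟩ := isCompact_univ.elim_finite_subcover
    (fun x : X.LeftSeq => {y : X.LeftSeq | y.trunc (m x) ∈ ({x.trunc (m x)} : Set X.Word)})
    (fun x => (X.isClopen_trunc _ _).2) (fun x _ => Set.mem_iUnion.mpr ⟨x, rfl⟩)
  obtain ⟨M, hM⟩ := (t.finite_toSet.image m).bddAbove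
  refine ⟨M + 1, by omega, fun v hv => ?_⟩
  have : Nonempty X.Letter := by
    cases v with
    | nil => simp at hv
    | cons a v => exact ⟨a⟩
  obtain ⟨y, hy⟩ := exists_trunc_eq v
  obtain ⟨x, hx⟩ := Set.mem_iUnion.mp (ht (Set.mem_univ y))
  obtain ⟨hxt, hyx⟩ := Set.mem_iUnion.mp hx
  have hxM : m x ≤ M := hM ⟨x, hxt, rfl⟩
  refine ⟨U x, hU𝒰 x, ?_⟩
  rintro f hf _ ⟨z, hz, rfl⟩
  change z.trunc (X.act f v).length = X.act f v at hz
  rw [act_length] at hz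
  obtain ⟨k, hk⟩ := Nat.exists_eq_add_of_le' (hxM.trans (by omega : M ≤ v.length))
  rw [hk] at hz hy
  rw [← hy] at hz
  refine hmU x (X.sec f ((y.trunc (k + m x)).take k)) ⟨f, hf, _, rfl⟩ z ?_
  change y.trunc (m x) = x.trunc (m x) at hyx
  rw [← hyx]
  exact (act_sec_trunc hz.symm).symm

end SelfSimilar

end BisetBasis

namespace BisetBasis

variable {G : Type u} {B : Type v} [Group G] [MulAction G B] [MulAction Gᵐᵒᵖ B]

/-! ### From finite partitions to the covering dimension -/

/-- Words `vw` of length `n`, with `v` of length `m` in `V`. -/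
def suffixExt (X : BisetBasis G B) (m n : ℕ) (V : Set X.Word) : Set X.Word :=
  {w | w.length = n ∧ w.take m ∈ V}

theorem LocalGen.take {X : BisetBasis G B} {A : Set G} {V : Set X.Word} {m n : ℕ} {w : X.Word}
    {g : G} (hg : X.LocalGen A (X.suffixExt m n V) w g) : X.LocalGen A V (w.take m) g := by
  induction hg with
  | one hv => exact .one hv.2
  | step _ ha hV ih =>
    refine ih.step ha ?_
    rw [← act_take]
    exact hV.2

section SelfSimilar

variable [SMulCommClass G Gᵐᵒᵖ B] [SelfSimilarGroup G B] {X : BisetBasis G B} {N : Set G}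

/-- The orbit of a word under the groupoid generated by `A` within `V`. -/
def component (X : BisetBasis G B) (A : Set G) (V : Set X.Word) (c : X.Word) : Set X.Word :=
  {w | ∃ g, X.LocalGen A V c g ∧ X.act g c = w}

theorem LocalGen.component_subset {A : Set G} {V : Set X.Word} {c : X.Word} {g : G}
    (hg : X.LocalGen A V c g) : X.component A V (X.act g c) ⊆ X.component A V c := by
  rintro _ ⟨h, hh, rfl⟩
  exact ⟨h * g, hg.mul hh, X.act_mul h g c⟩

theorem LocalGen.component_eq {A : Set G} {V : Set X.Word} {c : X.Word} {g : G}
    (hg : X.LocalGen A V c g) : X.component A V (X.act g c) = X.component A V c := by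
  refine hg.component_subset.antisymm ?_
  have := hg.inv.component_subset
  rwa [act_inv_act] at this

/-- The words `a(u)` and `a'(u)` differ by `a' * a⁻¹`, which is a single generator from `N * N`. -/
theorem IsCore.component_eq (hN : X.IsCore N) {V : Set X.Word} {c c' u : X.Word} {a a' : G}
    (ha : a ∈ N) (ha' : a' ∈ N) (h : X.act a u ∈ X.component (N * N) V c)
    (h' : X.act a' u ∈ X.component (N * N) V c') :
    X.component (N * N) V c = X.component (N * N) V c' := by
  obtain ⟨g, hg, e⟩ := h
  obtain ⟨g', hg', e'⟩ := h'
  have hb : X.act (a' * a⁻¹) (X.act g c) = X.act g' c' := by rw [e, e', act_mul, act_inv_act]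
  have h1 : X.LocalGen (N * N) V (X.act g c) (a' * a⁻¹) :=
    .of hg.target_mem (Or.inl (Set.mul_mem_mul ha' (hN.inv_mem a ha)))
      (by rw [hb]; exact hg'.target_mem)
  rw [← hg.component_eq, ← h1.component_eq, hb, hg'.component_eq]

theorem IsCore.coveringDimLE (hN : X.IsCore N) {d : ℕ} (h : X.HasFinitePartition (N * N) d) :
    CoveringDimLE X.LimitSpace d := by
  obtain ⟨n, -, V, hV, -, hfin⟩ := h
  have hVn : ∀ i, ∀ v ∈ V i, v.length = n := fun i v hv => by
    have : v ∈ ⋃ i, V i := Set.mem_iUnion.mpr ⟨i, hv⟩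
    rwa [hV] at this
  have hVfin : ∀ i, (V i).Finite := fun i => (X.finite_length_eq n).subset (hVn i)
  choose Q hQ hQ' using fun i => (finiteGroupoid_iff (hVfin i)).mp (hfin i)
  intro 𝒰 hU hcov
  obtain ⟨k, -, hk⟩ := hN.exists_lebesgue hU hcov (hN.finite.mul (Set.finite_iUnion hQ))
  set W : Fin (d + 1) → Set X.Word := fun i => X.suffixExt n (n + k) (V i)
  -- Shrinking to points all of whose representatives are near the component makes the set open.
  set O : Fin (d + 1) → X.Word → Set X.LimitSpace := fun i c =>
    X.starSet (n + k) {u | ∃ a ∈ N, X.act a u ∈ X.component (N * N) (W i) c} with hO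
  refine ⟨{S | ∃ i, ∃ c ∈ W i, S = O i c}, ?_, ?_, ?_, fun y => ?_⟩
  · rintro _ ⟨i, c, -, rfl⟩
    exact hN.isOpen_starSet _ _
  · refine Set.eq_univ_of_forall fun y => ?_
    obtain ⟨z, rfl⟩ := X.proj_surjective y
    have : (z.trunc (n + k)).take n ∈ ⋃ i, V i := by
      rw [hV, Set.mem_ofPred_eq, List.length_take, LeftSeq.trunc_length]
      omega
    obtain ⟨i, hi⟩ := Set.mem_iUnion.mp this
    have hW : z.trunc (n + k) ∈ W i := ⟨z.trunc_length _, hi⟩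
    refine ⟨_, ⟨i, _, hW, rfl⟩, fun z' hz' => ?_⟩
    obtain ⟨a, ha, e⟩ := hN.proj_eq_iff.mp hz' (n + k)
    exact ⟨a, ha, 1, .one hW, by rw [e, act_one]⟩
  · rintro _ ⟨i, c, hc, rfl⟩
    obtain ⟨U, hU𝒰, hUc⟩ := hk (c.drop n) (by rw [List.length_drop, hc.1]; omega)
    refine ⟨U, hU𝒰, fun y hy => ?_⟩
    obtain ⟨z, rfl⟩ := X.proj_surjective y
    obtain ⟨a, ha, g, hg, e⟩ := hy z rfl
    -- After the first `n` letters are dropped, `g` acts as one of finitely many `q`. Hence all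
    -- tiles of the component lie in images of one tile under the finite set used for the Lebesgue
    -- bound.
    obtain ⟨q, hq, hqg⟩ := hQ' i _ g hg.take
    set b := X.sec a⁻¹ ((X.act g c).take n)
    have hzk : z.trunc k = X.act (b * q) (c.drop n) := by
      have h1 : z.trunc (n + k) = X.act a⁻¹ (X.act g c) := by rw [e, act_inv_act]
      rw [act_mul, ← hqg, ← act_drop, ← act_drop, ← h1, LeftSeq.trunc_drop]
    refine hUc (b * q) (Set.mul_mem_mul (hN.secClosed _ (hN.inv_mem a ha) _)
      (Set.mem_iUnion.mpr ⟨i, hq⟩)) ?_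
    rw [← hzk]
    exact X.proj_mem_tile z k
  -- At a given point the colour determines the set, so the point lies in at most `d + 1` sets.
  · have hex : ∀ S : {S ∈ {S | ∃ i, ∃ c ∈ W i, S = O i c} | y ∈ S},
        ∃ i, ∃ c, S.1 = O i c :=
      fun S => S.2.1.imp fun i ⟨c, _, h⟩ => ⟨c, h⟩
    choose i c hc using hex
    have hinj : Function.Injective i := by
      intro S S' he
      refine Subtype.ext ?_
      have h1 := S.2.2
      have h2 := S'.2.2
      rw [hc S, hc S', ← he]
      rw [hc S] at h1
      rw [hc S', ← he] at h2
      obtain ⟨z, rfl⟩ := X.proj_surjective y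
      obtain ⟨a, ha, h1⟩ := h1 z rfl
      obtain ⟨a', ha', h2⟩ := h2 z rfl
      simp only [hO]
      rw [hN.component_eq ha ha' h1 h2]
    have := ENat.card_le_card_of_injective hinj
    have hcard : ENat.card (Fin (d + 1)) = d + 1 := by simp
    rwa [hcard] at this

end SelfSimilar

end BisetBasis

namespace BisetBasis

variable {G : Type u} {B : Type v} [Group G] [MulAction G B] [MulAction Gᵐᵒᵖ B]

/-! ### From the covering dimension to finite partitions -/

/-- The elements that arise, on every level, as sections of elements of `N` fixing the truncation
of `x`. This is the stabilizer of a point of the limit `G`-space. -/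
def stabSet (X : BisetBasis G B) (N : Set G) (x : X.LeftSeq) : Set G :=
  {g | ∀ n, ∃ e ∈ N, X.act e (x.trunc n) = x.trunc n ∧ X.sec e (x.trunc n) = g}

theorem stabSet_subset {X : BisetBasis G B} {N : Set G} (x : X.LeftSeq) : X.stabSet N x ⊆ N := by
  intro g hg
  obtain ⟨e, he, -, rfl⟩ := hg 0
  exact he

theorem IsCore.mem_stabSet_of_finite {X : BisetBasis G B} {N : Set G}
    (hN : X.IsCore N) {F : Set G} (hF : F.Finite) {x : X.LeftSeq}
    {g : G} (h : ∀ n, ∃ e ∈ F, X.act e (x.trunc n) = x.trunc n ∧ X.sec e (x.trunc n) = g) :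
    g ∈ X.stabSet N x := by
  intro n
  obtain ⟨k, hk⟩ := hN.absorbs.exists_of_finite hF
  obtain ⟨e, he, hx, hg⟩ := h (k + n)
  refine ⟨_, hk e he ((x.trunc (k + n)).take k) ?_, act_sec_trunc hx, ?_⟩
  · rw [List.length_take, LeftSeq.trunc_length]
    omega
  · rw [← hg, X.sec_take_drop e k (x.trunc (k + n)), LeftSeq.trunc_drop]

/-- An element outside the stabilizer fails to occur as such a section on some level, and then on
all deeper ones since `F` is closed under sections. Only finitely many candidates have to be
excluded. -/
theorem IsCore.exists_level_stabSet {X : BisetBasis G B} {N : Set G}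
    (hN : X.IsCore N) {F : Set G} (hF : F.Finite)
    (hs : X.SecClosed F) (x : X.LeftSeq) : ∃ m, ∀ e ∈ F, X.act e (x.trunc m) = x.trunc m →
      X.sec e (x.trunc m) ∈ X.stabSet N x := by
  have hex : ∀ g, ∃ n, g ∉ X.stabSet N x → ∀ e ∈ F, X.act e (x.trunc n) = x.trunc n →
      X.sec e (x.trunc n) ≠ g := by
    intro g
    by_contra! hcon
    exact (hcon 0).1 (hN.mem_stabSet_of_finite hF fun n => (hcon n).2)
  choose n hn using hex
  obtain ⟨m, hm⟩ := (hF.image n).bddAbove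
  refine ⟨m, fun e he hfix => by_contra fun hnot => ?_⟩
  obtain ⟨j, hj⟩ := Nat.exists_eq_add_of_le' (hm ⟨_, hs e he (x.trunc m), rfl⟩)
  have hj' : x.trunc m = x.trunc (j + n (X.sec e (x.trunc m))) := congrArg _ hj
  have hfix' := hfix
  rw [hj'] at hfix'
  refine hn _ hnot _ (hs e he _) (act_sec_trunc hfix') ?_
  conv_rhs => rw [hj', X.sec_take_drop e j, LeftSeq.trunc_drop]

section SelfSimilar

variable [SMulCommClass G Gᵐᵒᵖ B] [SelfSimilarGroup G B] {X : BisetBasis G B} {N : Set G}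

theorem IsCore.one_mem_stabSet (hN : X.IsCore N) (x : X.LeftSeq) : 1 ∈ X.stabSet N x := fun _ =>
  ⟨1, hN.one_mem, X.act_one _, X.sec_one _⟩

theorem IsCore.mul_mem_stabSet (hN : X.IsCore N) {x : X.LeftSeq} {g h : G}
    (hg : g ∈ X.stabSet N x) (hh : h ∈ X.stabSet N x) : g * h ∈ X.stabSet N x := by
  refine hN.mem_stabSet_of_finite (hN.finite.mul hN.finite) fun n => ?_
  obtain ⟨a, ha, hax, rfl⟩ := hg n
  obtain ⟨b, hb, hbx, rfl⟩ := hh n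
  refine ⟨a * b, Set.mul_mem_mul ha hb, ?_, ?_⟩
  · rw [act_mul, hbx, hax]
  · rw [sec_mul, hbx]

/-! ### Colouring words by stable families of cover elements -/

theorem drop_mem_of_tile_subset [Nonempty X.Letter] {v : X.Word} {m : ℕ} {P : Set X.Word}
    (hm : m ≤ v.length) (h : X.tile v ⊆ X.starSet m P) : v.drop (v.length - m) ∈ P := by
  obtain ⟨z, hz⟩ := exists_trunc_eq v
  have h1 : X.proj z ∈ X.starSet m P := h ⟨z, hz, rfl⟩
  have h2 := z.trunc_drop (v.length - m) m
  rw [Nat.sub_add_cancel hm, hz] at h2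
  rw [h2]
  exact h1 z rfl

/-- The elements of a family of sets that contain the tiles at distance at most `r` from `v`. -/
def deepSets (X : BisetBasis G B) (N : Set G) (𝒱 : Set (Set X.LimitSpace)) (r : ℕ) (v : X.Word) :
    Set (Set X.LimitSpace) := {V ∈ 𝒱 | ∀ e ∈ N ^ r, X.tile (X.act e v) ⊆ V}

theorem deepSets_succ_subset (𝒱 : Set (Set X.LimitSpace)) (r : ℕ) (v : X.Word) {a : G} (ha : a ∈ N) :
    X.deepSets N 𝒱 (r + 1) v ⊆ X.deepSets N 𝒱 r (X.act a v) := by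
  rintro V ⟨hV, h⟩
  refine ⟨hV, fun e he => ?_⟩
  rw [← act_mul]
  exact h _ (by rw [pow_succ]; exact Set.mul_mem_mul he ha)

theorem IsCore.deepSets_antitone (hN : X.IsCore N) (𝒱 : Set (Set X.LimitSpace)) (v : X.Word) :
    Antitone fun r => X.deepSets N 𝒱 r v := by
  refine antitone_nat_of_succ_le fun r => ?_
  have := deepSets_succ_subset 𝒱 r v hN.one_mem
  rwa [act_one] at this

/-- The sizes for radii `0, …, d + 1` are `d + 2` non-increasing numbers between `1` and `d + 1`, so
two consecutive families coincide. -/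
theorem IsCore.exists_deepSets_eq (hN : X.IsCore N) {𝒱 : Set (Set X.LimitSpace)} {d : ℕ}
    {v : X.Word} (h0 : (X.deepSets N 𝒱 0 v).encard ≤ d + 1)
    (hd : (X.deepSets N 𝒱 (d + 1) v).Nonempty) :
    ∃ r, X.deepSets N 𝒱 r v = X.deepSets N 𝒱 (r + 1) v ∧
      (X.deepSets N 𝒱 r v).Finite ∧ (X.deepSets N 𝒱 r v).ncard ∈ Set.Icc 1 (d + 1) := by
  have hanti := hN.deepSets_antitone 𝒱 v
  have h0f : (X.deepSets N 𝒱 0 v).Finite :=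
    Set.finite_of_encard_le_coe (k := d + 1) (by exact_mod_cast h0)
  have hf : ∀ r, (X.deepSets N 𝒱 r v).Finite := fun r => h0f.subset (hanti (Nat.zero_le r))
  have h0c : (X.deepSets N 𝒱 0 v).ncard ≤ d + 1 := by
    rw [← h0f.cast_ncard_eq] at h0
    exact_mod_cast h0
  have hpos : 0 < (X.deepSets N 𝒱 (d + 1) v).ncard := (Set.ncard_pos (hf _)).mpr hd
  obtain ⟨r, hr, he⟩ : ∃ r ≤ d, X.deepSets N 𝒱 r v = X.deepSets N 𝒱 (r + 1) v := by
    by_contra! hcon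
    have : ∀ r ≤ d + 1, (X.deepSets N 𝒱 r v).ncard + r ≤ d + 1 := by
      intro r
      induction r with
      | zero => exact fun _ => h0c
      | succ r ih =>
        intro hr
        have h1 := ih (by omega)
        have h2 := Set.ncard_lt_ncard
          ((hanti (Nat.le_succ r)).ssubset_of_ne (hcon r (by omega)).symm) (hf r)
        simp only [Nat.succ_eq_add_one] at h2
        omega
    have := this (d + 1) le_rfl
    omega
  refine ⟨r, he, hf r, ?_, (Set.ncard_le_ncard (hanti (Nat.zero_le r)) h0f).trans h0c⟩
  exact hpos.trans_le (Set.ncard_le_ncard (hanti (by omega : r ≤ d + 1)) (hf r))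

theorem hasFinitePartition_of_isEmpty [IsEmpty X.Letter] (A : Set G) (d : ℕ) :
    X.HasFinitePartition A d := by
  refine ⟨1, le_rfl, fun _ => ∅, ?_, fun _ _ _ => Set.disjoint_empty _, fun i => ?_⟩
  · rw [Set.iUnion_empty, eq_comm, Set.eq_empty_iff_forall_notMem]
    intro v hv
    cases v with
    | nil => simp at hv
    | cons a v => exact isEmptyElim a
  · exact (finiteGroupoid_iff Set.finite_empty).mpr
      ⟨∅, Set.finite_empty, fun v g hg => hg.source_mem.elim⟩

theorem IsCore.hasFinitePartition_of_coveringDimLE (hN : X.IsCore N) {d : ℕ}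
    (h : CoveringDimLE X.LimitSpace d) : X.HasFinitePartition N d := by
  rcases isEmpty_or_nonempty X.Letter with hX | hX
  · exact hasFinitePartition_of_isEmpty N d
  -- The triple product accommodates the elements `c''⁻¹ * b * c'` that fix the truncation of `x`
  -- below.
  choose m hm using hN.exists_level_stabSet ((hN.finite.mul hN.finite).mul hN.finite)
    ((hN.secClosed.mul hN.secClosed).mul hN.secClosed)
  set Ω : X.LeftSeq → Set X.LimitSpace := fun x =>
    X.starSet (m x) {w | ∃ a ∈ N, X.act a (x.trunc (m x)) = w} with hΩ
  obtain ⟨t, ht⟩ := isCompact_univ.elim_finite_subcover Ω (fun x => hN.isOpen_starSet _ _) (by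
    intro y _
    obtain ⟨x, rfl⟩ := X.proj_surjective y
    exact Set.mem_iUnion.mpr ⟨x, fun z hz => hN.proj_eq_iff.mp hz.symm _⟩)
  obtain ⟨𝒱, hVo, hVc, hVr, hVd⟩ := h (Ω '' t) (by
    rintro _ ⟨x, -, rfl⟩
    exact hN.isOpen_starSet _ _) (Set.eq_univ_of_forall fun y => by
      obtain ⟨x, hx⟩ := Set.mem_iUnion.mp (ht (Set.mem_univ y))
      obtain ⟨hxt, hx⟩ := Set.mem_iUnion.mp hx
      exact ⟨Ω x, ⟨x, hxt, rfl⟩, hx⟩)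
  obtain ⟨m₀, hm₀, hleb⟩ := hN.exists_lebesgue hVo hVc (finite_pow hN.finite (d + 1))
  obtain ⟨M, hM⟩ := (t.finite_toSet.image m).bddAbove
  set n := m₀ + M with hn
  have hmn : ∀ x ∈ t, m x ≤ n := fun x hx => (hM ⟨x, hx, rfl⟩).trans (Nat.le_add_left _ _)
  have hr : ∀ v : X.Word, ∃ r, v.length = n →
      X.deepSets N 𝒱 r v = X.deepSets N 𝒱 (r + 1) v ∧
      (X.deepSets N 𝒱 r v).Finite ∧ (X.deepSets N 𝒱 r v).ncard ∈ Set.Icc 1 (d + 1) := by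
    intro v
    by_cases hv : v.length = n
    · obtain ⟨z, hz⟩ := exists_trunc_eq v
      have h0 : (X.deepSets N 𝒱 0 v).encard ≤ d + 1 := by
        refine (Set.encard_le_encard ?_).trans (hVd (X.proj z))
        rintro V ⟨hV, hvV⟩
        refine ⟨hV, ?_⟩
        have := hvV 1 (by simp)
        rw [act_one] at this
        exact this ⟨z, hz, rfl⟩
      obtain ⟨U, hU, hUv⟩ := hleb v (by omega)
      obtain ⟨r, hr⟩ := hN.exists_deepSets_eq h0 ⟨U, hU, hUv⟩
      exact ⟨r, fun _ => hr⟩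
    · exact ⟨0, fun h => absurd h hv⟩
  choose r hr using hr
  set L : X.Word → Set (Set X.LimitSpace) := fun v => X.deepSets N 𝒱 (r v) v with hL
  -- By stability `L (a(v))` is also the family of radius `r (a(v)) + 1`. It is therefore contained
  -- in the family of `v` of radius `r (a(v)) ≥ r v`, hence in `L v`; equal sizes give equality.
  have hadj1 : ∀ v a, v.length = n → a ∈ N → r v ≤ r (X.act a v) →
      (L v).ncard = (L (X.act a v)).ncard → L (X.act a v) = L v := by
    intro v a hv ha hle hcard
    refine Set.eq_of_subset_of_ncard_le ?_ hcard.le (hr v hv).2.1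
    simp only [hL]
    rw [(hr _ (by rwa [act_length])).1]
    have := deepSets_succ_subset 𝒱 (r (X.act a v)) (X.act a v) (hN.inv_mem a ha)
    rw [act_inv_act] at this
    exact this.trans (hN.deepSets_antitone 𝒱 v hle)
  have hadj : ∀ v a, v.length = n → a ∈ N →
      (L v).ncard = (L (X.act a v)).ncard → L (X.act a v) = L v := by
    intro v a hv ha hcard
    rcases le_total (r v) (r (X.act a v)) with hle | hle
    · exact hadj1 v a hv ha hle hcard
    · have := hadj1 (X.act a v) a⁻¹ (by rwa [act_length]) (hN.inv_mem a ha)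
        (by rwa [act_inv_act]) (by rw [act_inv_act, hcard])
      rw [act_inv_act] at this
      exact this.symm
  refine ⟨n, by omega, fun i => {v | v.length = n ∧ (L v).ncard = i + 1}, ?_, ?_, fun i => ?_⟩
  · ext v
    simp only [Set.mem_iUnion, Set.mem_ofPred_eq]
    refine ⟨fun ⟨_, h, _⟩ => h, fun hv => ?_⟩
    obtain ⟨h1, h2⟩ := (hr v hv).2.2
    exact ⟨⟨(L v).ncard - 1, by simp only [hL]; omega⟩, hv, by
      change _ = (L v).ncard - 1 + 1
      simp only [hL]
      omega⟩
  · intro i j hij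
    refine Set.disjoint_left.mpr fun v hv hv' => hij (Fin.ext ?_)
    have := hv.2.symm.trans hv'.2
    omega
  · refine (finiteGroupoid_iff ((X.finite_length_eq n).subset fun v hv => hv.1)).mpr
      ⟨N * N * N, (hN.finite.mul hN.finite).mul hN.finite, fun v g hg =>
        ⟨X.sec g v, ?_, fun _ => rfl⟩⟩
    obtain ⟨hv, -⟩ := hg.source_mem
    obtain ⟨V, hV⟩ : (L v).Nonempty :=
      (Set.ncard_pos (hr v hv).2.1).mp ((hr v hv).2.2.1)
    obtain ⟨_, ⟨x, hx, rfl⟩, hVx⟩ := hVr V hV.1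
    have hmem : ∀ w : X.Word, w.length = n → V ∈ L w →
        ∃ c ∈ N, X.act c (x.trunc (m x)) = w.drop (n - m x) := by
      intro w hw hVw
      have h1 := hVw.2 1 (Set.one_mem_pow hN.one_mem)
      rw [act_one] at h1
      have := drop_mem_of_tile_subset (by rw [hw]; exact hmn x hx) (h1.trans hVx)
      rwa [hw] at this
    obtain ⟨c, hc, hcv⟩ := hmem v hv hV
    -- The family is constant along the path, so all words on it end with `N`-images of the same
    -- truncation of `x`. Comparing consecutive images through that truncation changes the section
    -- only by a stabilizer element.
    have key : L (X.act g v) = L v ∧ ∃ c' ∈ N,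
        X.act c' (x.trunc (m x)) = (X.act g v).drop (n - m x) ∧ ∃ s ∈ X.stabSet N x,
          X.sec g v = X.sec c' (x.trunc (m x)) * s * (X.sec c (x.trunc (m x)))⁻¹ := by
      induction hg with
      | one _ =>
        refine ⟨by rw [act_one], c, hc, by rw [act_one, hcv], 1, hN.one_mem_stabSet x, ?_⟩
        rw [sec_one, mul_one, mul_inv_cancel]
      | @step g a hg ha hgV ih =>
        obtain ⟨hLg, c', hc', hcg, s, hs, hsec⟩ := ih
        have ha : a ∈ N := ha.elim id fun h => by simpa using hN.inv_mem _ h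
        have hLag : L (X.act (a * g) v) = L v := by
          rw [← hLg, act_mul]
          refine hadj _ a (by rwa [act_length]) ha ?_
          rw [hg.target_mem.2, ← act_mul, hgV.2]
        obtain ⟨c'', hc'', hcag⟩ := hmem (X.act (a * g) v) (by rwa [act_length])
          (by rw [hLag]; exact hV)
        set b := X.sec a ((X.act g v).take (n - m x))
        have hb : X.act b (X.act c' (x.trunc (m x))) = X.act c'' (x.trunc (m x)) := by
          rw [hcg, hcag, ← act_drop, ← act_mul]
        have hstab := hm x (c''⁻¹ * b * c') (Set.mul_mem_mul (Set.mul_mem_mul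
          (hN.inv_mem _ hc'') (hN.secClosed a ha _)) hc') (by
            rw [act_mul, act_mul, hb, act_inv_act])
        refine ⟨hLag, c'', hc'', hcag, _, hN.mul_mem_stabSet hstab hs, ?_⟩
        rw [sec_mul, sec_mul, sec_mul, hb, sec_inv, X.sec_take_drop a (n - m x) (X.act g v), ← hcg,
          hsec]
        change X.sec b _ * _ = _
        group
    obtain ⟨-, c', hc', -, s, hs, hsec⟩ := key
    rw [hsec]
    exact Set.mul_mem_mul (Set.mul_mem_mul (hN.secClosed c' hc' _) (stabSet_subset x hs))
      (hN.inv_mem _ (hN.secClosed c hc _))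

end SelfSimilar

end BisetBasis

namespace BisetBasis

/-! ### Prefixes of points of the boundary -/

section Prefix

variable {G : Type u} {B : Type v} [Group G] [MulAction Gᵐᵒᵖ B] {X : BisetBasis G B}

/-- The prefix `x₁ x₂ … xₙ` of an infinite sequence. -/
def Boundary.pre (x : X.Boundary) : ℕ → X.Word
  | 0 => []
  | n + 1 => x.pre n ++ [x n]

theorem Boundary.pre_length (x : X.Boundary) (n : ℕ) : (x.pre n).length = n := by
  induction n with
  | zero => rfl
  | succ n ih => simp [Boundary.pre, ih]

theorem Boundary.pre_take (x : X.Boundary) {m n : ℕ} (h : n ≤ m) : (x.pre m).take n = x.pre n := by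
  induction m, h using Nat.le_induction with
  | base => rw [List.take_of_length_le (x.pre_length n).le]
  | succ m h ih => rw [Boundary.pre, List.take_append_of_le_length (by rwa [x.pre_length]), ih]

theorem Boundary.ext_pre {x y : X.Boundary} (k : ℕ) (h : ∀ n, k ≤ n → x.pre n = y.pre n) :
    x = y := by
  funext j
  have h1 := congrArg (List.take (j + 1)) (h (max k (j + 1)) (le_max_left _ _))
  rw [x.pre_take (le_max_right _ _), y.pre_take (le_max_right _ _)] at h1
  exact List.singleton_inj.mp
    (List.append_inj h1 (by rw [x.pre_length, y.pre_length])).2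

theorem exists_pre_eq [Nonempty X.Letter] (v : X.Word) :
    ∃ x : X.Boundary, x.pre v.length = v := by
  refine ⟨fun k => v.getD k (Classical.arbitrary _), ?_⟩
  have : ∀ n, n ≤ v.length →
      Boundary.pre (fun k => v.getD k (Classical.arbitrary _) : X.Boundary) n = v.take n := by
    intro n
    induction n with
    | zero => intro _; rfl
    | succ n ih =>
      intro hn
      change Boundary.pre _ n ++ [v.getD n _] = _
      rw [ih (by omega), List.take_add_one]
      simp [List.getD, List.getElem?_eq_getElem (show n < v.length by omega)]
  rw [this _ le_rfl, List.take_length]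

end Prefix

variable {G : Type u} {B : Type v} [Group G] [MulAction G B] [MulAction Gᵐᵒᵖ B]

theorem prefixSec_eq (X : BisetBasis G B) (g : G) (x : X.Boundary) (n : ℕ) :
    X.prefixSec g x n = X.sec g (x.pre n) := by
  induction n with
  | zero => rfl
  | succ n ih => rw [prefixSec, ih, Boundary.pre, sec_append]; rfl

theorem pre_smul (X : BisetBasis G B) (g : G) (x : X.Boundary) (n : ℕ) :
    (g • x).pre n = X.act g (x.pre n) := by
  induction n with
  | zero => rfl
  | succ n ih =>
    rw [Boundary.pre, Boundary.pre, ih, act_append, boundary_smul_apply, prefixSec_eq]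
    rfl

theorem smul_eq_of_act_eq {X : BisetBasis G B} {g h : G} {v : X.Word}
    (e : ∀ u, v <+: u → X.act g u = X.act h u) {x : X.Boundary} (hx : x.pre v.length = v) :
    g • x = h • x := by
  refine Boundary.ext_pre v.length fun n hn => ?_
  rw [pre_smul, pre_smul]
  refine e _ ?_
  rw [← hx, ← x.pre_take hn]
  exact List.take_prefix _ _

theorem act_sec_eq_of_smul_eq {X : BisetBasis G B} [Nonempty X.Letter] {g h : G} {v : X.Word}
    (e : ∀ x : X.Boundary, x.pre v.length = v → g • x = h • x) (t : X.Word) :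
    X.act (X.sec g v) t = X.act (X.sec h v) t := by
  obtain ⟨x, hx⟩ := exists_pre_eq (v ++ t)
  have hv : x.pre v.length = v := by
    rw [← x.pre_take (m := (v ++ t).length) (by simp), hx, List.take_left]
  have := congrArg (fun y => Boundary.pre y (v ++ t).length) (e x hv)
  simp only [pre_smul, hx, act_append] at this
  exact (List.append_inj this (by rw [act_length, act_length])).2

section SelfSimilar

variable [SMulCommClass G Gᵐᵒᵖ B] [SelfSimilarGroup G B]

instance (X : BisetBasis G B) : CompactSpace X.Boundary :=
  inferInstanceAs (CompactSpace (ℕ → X.Letter))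

theorem isClopen_pre (X : BisetBasis G B) (n : ℕ) (P : Set X.Word) :
    IsClopen {x : X.Boundary | x.pre n ∈ P} := by
  induction n generalizing P with
  | zero =>
    by_cases h : [] ∈ P
    · convert isClopen_univ
      exact Set.eq_univ_of_forall fun _ => h
    · convert isClopen_empty
      exact Set.eq_empty_of_forall_notMem fun _ => h
  | succ n ih =>
    have : {x : X.Boundary | x.pre (n + 1) ∈ P} =
        ⋃ a : X.Letter, {x : X.Boundary | x n = a} ∩ {x | x.pre n ∈ {w | w ++ [a] ∈ P}} := by
      ext x
      rw [Set.mem_iUnion]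
      exact ⟨fun h => ⟨x n, rfl, h⟩, fun ⟨a, ha, h⟩ => by subst ha; exact h⟩
    rw [this]
    refine isClopen_iUnion_of_finite fun a => IsClopen.inter ?_ (ih _)
    exact (isClopen_discrete {a}).preimage (continuous_apply (A := fun _ : ℕ => X.Letter) n)

variable {X : BisetBasis G B} {N : Set G}

theorem exists_cylinder_subset {U : Set X.Boundary} (hU : IsOpen U) {x : X.Boundary}
    (hx : x ∈ U) : ∃ n, {y : X.Boundary | y.pre n = x.pre n} ⊆ U := by
  by_contra! hcon
  have hclosed : ∀ n, IsClosed ({y : X.Boundary | y.pre n = x.pre n} ∩ Uᶜ) := fun n =>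
    (X.isClopen_pre n {x.pre n}).1.inter hU.isClosed_compl
  have hne : (⋂ n, ({y : X.Boundary | y.pre n = x.pre n} ∩ Uᶜ)).Nonempty :=
    IsCompact.nonempty_iInter_of_sequence_nonempty_isCompact_isClosed _ (fun n => by
      rintro y ⟨hy, hyU⟩
      exact ⟨(List.append_inj hy (by rw [y.pre_length, x.pre_length])).1, hyU⟩)
    (fun n => Set.not_subset.mp (hcon n)) (hclosed 0).isCompact hclosed
  obtain ⟨y, hy⟩ := hne
  rw [Set.mem_iInter] at hy
  have : y = x := Boundary.ext_pre 0 fun n _ => (hy n).1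
  exact (hy 0).2 (this ▸ hx)

/-- Long cylinders are subordinate to a given open cover of the boundary. -/
theorem exists_cylinder_lebesgue {ι : Type*} {U : ι → Set X.Boundary} (hU : ∀ i, IsOpen (U i))
    (hcov : ⋃ i, U i = Set.univ) :
    ∃ n, 1 ≤ n ∧ ∀ x : X.Boundary, ∃ i, {y : X.Boundary | y.pre n = x.pre n} ⊆ U i := by
  have hloc : ∀ x : X.Boundary, ∃ i n, {y : X.Boundary | y.pre n = x.pre n} ⊆ U i := by
    intro x
    obtain ⟨i, hi⟩ := Set.mem_iUnion.mp (hcov.symm ▸ Set.mem_univ x : x ∈ ⋃ i, U i)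
    exact ⟨i, exists_cylinder_subset (hU i) hi⟩
  choose i n hn using hloc
  obtain ⟨t, ht⟩ := isCompact_univ.elim_finite_subcover
    (fun x : X.Boundary => {y : X.Boundary | y.pre (n x) ∈ ({x.pre (n x)} : Set X.Word)})
    (fun x => (X.isClopen_pre _ _).2) (fun x _ => Set.mem_iUnion.mpr ⟨x, rfl⟩)
  obtain ⟨M, hM⟩ := (t.finite_toSet.image n).bddAbove
  refine ⟨M + 1, by omega, fun x => ?_⟩
  obtain ⟨z, hz⟩ := Set.mem_iUnion.mp (ht (Set.mem_univ x))
  obtain ⟨hzt, hxz⟩ := Set.mem_iUnion.mp hz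
  have hzM : n z ≤ M + 1 := (hM ⟨z, hzt, rfl⟩).trans (Nat.le_succ M)
  refine ⟨i z, fun y hy => hn z ?_⟩
  change y.pre (M + 1) = x.pre (M + 1) at hy
  change y.pre (n z) = z.pre (n z)
  change x.pre (n z) = z.pre (n z) at hxz
  rw [← y.pre_take hzM, hy, x.pre_take hzM, hxz]

/-! ### Germs -/

theorem total_mk_eq_germ {x y : X.Boundary} (p : {g : G // g • x = y}) :
    (⟨x, y, Quotient.mk (X.germSetoid x y) p⟩ : Quiver.Total X.Boundary) = X.germ (p.1, x) := by
  obtain ⟨g, rfl⟩ := p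
  rfl

theorem germ_surjective (X : BisetBasis G B) : Function.Surjective X.germ := by
  rintro ⟨x, y, ⟨p⟩⟩
  exact ⟨(p.1, x), (total_mk_eq_germ p).symm⟩

theorem germ_eq_germ_iff {g h : G} {x y : X.Boundary} :
    X.germ (g, x) = X.germ (h, y) ↔ x = y ∧ ∀ᶠ z in 𝓝 x, g • z = h • z := by
  constructor
  · intro e
    -- Generalizing the first germ avoids a heterogeneous equality between morphisms.
    have key : ∀ (γ : Quiver.Total X.Boundary), γ = X.germ (h, y) → γ.left = y ∧
        ∀ p : {g : G // g • γ.left = γ.right}, Quotient.mk (X.germSetoid γ.left γ.right) p = γ.hom →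
          ∀ᶠ z in 𝓝 γ.left, p.1 • z = h • z := by
      rintro _ rfl
      exact ⟨rfl, fun p hp => Quotient.exact hp⟩
    obtain ⟨h1, h2⟩ := key _ e
    exact ⟨h1, h2 ⟨g, rfl⟩ rfl⟩
  · rintro ⟨rfl, e⟩
    have hx : g • x = h • x := e.self_of_nhds
    rw [← total_mk_eq_germ (⟨h, hx.symm⟩ : {k : G // k • x = g • x})]
    have : Quotient.mk (X.germSetoid x (g • x)) ⟨g, rfl⟩ =
      Quotient.mk (X.germSetoid x (g • x)) ⟨h, hx.symm⟩ := Quotient.sound e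
    rw [← this]
    rfl

theorem continuous_germ (X : BisetBasis G B) (g : G) :
    Continuous fun x : X.Boundary => X.germ (g, x) := by
  let _ : TopologicalSpace G := ⊥
  have h : Continuous X.germ := continuous_coinduced_rng
  exact h.comp (Continuous.prodMk_right g)

/-- Its preimage in the slice of `h` is the set of points near which `g` and `h` agree, and this set
is open. -/
theorem isOpen_germ_image (X : BisetBasis G B) (g : G) :
    IsOpen (Set.range fun x : X.Boundary => X.germ (g, x)) := by
  let _ : TopologicalSpace G := ⊥
  have : DiscreteTopology G := ⟨rfl⟩
  refine isOpen_coinduced.mpr ?_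
  have : X.germ ⁻¹' (Set.range fun x : X.Boundary => X.germ (g, x)) =
      ⋃ h : G, Prod.fst ⁻¹' {h} ∩ Prod.snd ⁻¹' {x : X.Boundary | ∀ᶠ z in 𝓝 x, g • z = h • z} := by
    ext ⟨h, x⟩
    rw [Set.mem_iUnion]
    constructor
    · rintro ⟨y, hy⟩
      obtain ⟨rfl, e⟩ := germ_eq_germ_iff.mp hy
      exact ⟨h, rfl, e⟩
    · rintro ⟨_, rfl, e⟩
      exact ⟨x, germ_eq_germ_iff.mpr ⟨rfl, e⟩⟩
  rw [this]
  exact isOpen_iUnion fun h => ((isOpen_discrete {h}).preimage continuous_fst).inter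
    (isOpen_setOfPred_eventually_nhds.preimage continuous_snd)

theorem exists_finite_germ {K : Set (Quiver.Total X.Boundary)} (hK : IsCompact K) :
    ∃ A : Set G, A.Finite ∧ ∀ γ ∈ K, ∃ g ∈ A, ∃ x, γ = X.germ (g, x) := by
  obtain ⟨t, ht⟩ := hK.elim_finite_subcover _ X.isOpen_germ_image (fun γ _ => by
    obtain ⟨⟨g, x⟩, rfl⟩ := X.germ_surjective γ
    exact Set.mem_iUnion.mpr ⟨g, x, rfl⟩)
  refine ⟨t, t.finite_toSet, fun γ hγ => ?_⟩
  obtain ⟨g, hg⟩ := Set.mem_iUnion.mp (ht hγ)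
  obtain ⟨hgt, x, hx⟩ := Set.mem_iUnion.mp hg
  exact ⟨g, hgt, x, hx.symm⟩

theorem continuous_total_left (X : BisetBasis G B) :
    Continuous fun γ : Quiver.Total X.Boundary => γ.left := by
  let _ : TopologicalSpace G := ⊥
  exact continuous_coinduced_dom.mpr continuous_snd

theorem isOpen_unitTopology_iff {U : Set X.Boundary} :
    IsOpen[unitTopology X.Boundary] U ↔ IsOpen U := by
  constructor
  · rintro ⟨O, hO, rfl⟩
    have : (fun c : X.Boundary => (⟨c, c, 𝟙 c⟩ : Quiver.Total X.Boundary)) =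
        fun c => X.germ (1, c) := by
      funext c
      exact total_mk_eq_germ ⟨1, one_smul G c⟩
    rw [this]
    exact hO.preimage (X.continuous_germ 1)
  · intro h
    exact ⟨_, h.preimage X.continuous_total_left, rfl⟩

/-! ### From finite partitions to the groupoid of germs -/

/-- The subgroupoid of germs of the elements of the groupoid generated by `A` within a set of words
of length `n`. -/
def localGroupoid (X : BisetBasis G B) (A : Set G) (V : Set X.Word) (n : ℕ) :
    Subgroupoid X.Boundary where
  arrows x y := {q | ∃ g, X.LocalGen A V (x.pre n) g ∧
    ∃ e : g • x = y, q = Quotient.mk (X.germSetoid x y) ⟨g, e⟩}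
  inv := by
    rintro x y _ ⟨g, hg, rfl, rfl⟩
    refine ⟨g⁻¹, ?_, inv_smul_smul g x, rfl⟩
    rw [pre_smul]
    exact hg.inv
  mul := by
    rintro x y z _ ⟨g, hg, rfl, rfl⟩ _ ⟨h, hh, rfl, rfl⟩
    rw [pre_smul] at hh
    exact ⟨h * g, hg.mul hh, mul_smul h g x, rfl⟩

theorem isCompact_localGroupoid {A : Set G} {V : Set X.Word} {n : ℕ} (hV : ∀ v ∈ V, v.length = n)
    (h : X.FiniteGroupoid A V) :
    IsCompact {γ : Quiver.Total X.Boundary |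
      γ.hom ∈ (X.localGroupoid A V n).arrows γ.left γ.right} := by
  obtain ⟨Q, hQ, hQ'⟩ := h.exists_localGen
  have hVf : V.Finite := (X.finite_length_eq n).subset hV
  -- Finitely many representatives over finitely many cylinders exhaust the subgroupoid, so it is a
  -- finite union of continuous images of compact sets.
  have : {γ : Quiver.Total X.Boundary |
      γ.hom ∈ (X.localGroupoid A V n).arrows γ.left γ.right} =
      ⋃ p ∈ {p : X.Word × G | (p.1 ∈ V ∧ p.2 ∈ Q) ∧ X.LocalGen A V p.1 p.2},
        (fun x => X.germ (p.2, x)) '' {x | x.pre n ∈ ({p.1} : Set X.Word)} := by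
    ext γ
    rw [Set.mem_iUnion₂]
    constructor
    · obtain ⟨x, y, q⟩ := γ
      rintro ⟨g, hg, e, e'⟩
      dsimp only at hg e e'
      subst e e'
      obtain ⟨q, hq, hlq, hgq⟩ := hQ' _ g hg
      refine ⟨(x.pre n, q), ⟨⟨hg.source_mem, hq⟩, hlq⟩, x, rfl, ?_⟩
      rw [total_mk_eq_germ, germ_eq_germ_iff]
      refine ⟨rfl, ?_⟩
      filter_upwards [(X.isClopen_pre n {x.pre n}).2.mem_nhds rfl] with z hz
      refine (smul_eq_of_act_eq hgq ?_).symm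
      rw [x.pre_length]
      exact hz
    · rintro ⟨⟨v, q⟩, ⟨-, hq⟩, x, hx, rfl⟩
      change x.pre n = v at hx
      subst hx
      exact ⟨q, hq, rfl, rfl⟩
  rw [this]
  refine Set.Finite.isCompact_biUnion ((hVf.prod hQ).subset fun p hp => hp.1) fun p _ => ?_
  exact (X.isClopen_pre n _).1.isCompact.image (X.continuous_germ p.2)

theorem dadProperty_of_hasFinitePartition {d : ℕ}
    (h : ∀ A : Set G, A.Finite → X.HasFinitePartition A d) : DadProperty X.Boundary d := by
  intro K hK
  obtain ⟨A, hA, hKA⟩ := exists_finite_germ hK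
  obtain ⟨n, -, V, hV, -, hfin⟩ := h A hA
  have hVn : ∀ i, ∀ v ∈ V i, v.length = n := fun i v hv => by
    have : v ∈ ⋃ i, V i := Set.mem_iUnion.mpr ⟨i, hv⟩
    rwa [hV] at this
  refine ⟨fun i => {x | x.pre n ∈ V i}, fun i => isOpen_unitTopology_iff.mpr (X.isClopen_pre n _).2,
    ?_, fun i => ⟨X.localGroupoid A (V i) n, isCompact_localGroupoid (hVn i) (hfin i), ?_⟩⟩
  · refine Set.eq_univ_of_forall fun x => ?_
    have : x.pre n ∈ ⋃ i, V i := by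
      rw [hV]
      exact x.pre_length n
    obtain ⟨i, hi⟩ := Set.mem_iUnion.mp this
    exact Set.mem_iUnion.mpr ⟨i, hi⟩
  · intro γ hγ hl hr
    obtain ⟨g, hg, x, rfl⟩ := hKA γ hγ
    refine ⟨g, .of hl (Or.inl hg) ?_, rfl, rfl⟩
    rw [← pre_smul]
    exact hr

/-! ### From the groupoid of germs to finite partitions -/

theorem exists_finite_representatives {α β : Type*} (T : Set α) (f : α → β)
    (hf : (f '' T).Finite) : ∃ R ⊆ T, R.Finite ∧ ∀ a ∈ T, ∃ b ∈ R, f b = f a := by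
  obtain ⟨R, hR, hbij⟩ := Set.exists_subset_bijOn T f
  refine ⟨R, hR, Set.Finite.of_finite_image (hbij.image_eq ▸ hf) hbij.injOn, fun a ha => ?_⟩
  exact hbij.surjOn ⟨a, ha, rfl⟩

/-- If the germs at `x` of the elements of the local groupoid are represented by a finite set, then
the same holds uniformly on a neighbourhood of `x`. -/
theorem IsCore.exists_nhds_localGen (hN : X.IsCore N) {V : Set X.Word} {A : Set G} (hA : A.Finite)
    {v : X.Word} (x : X.Boundary)
    (h : ∀ g, X.LocalGen N V v g → ∃ a ∈ A, ∀ᶠ z in 𝓝 x, g • z = a • z) :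
    ∃ W ∈ 𝓝 x, ∀ g, X.LocalGen N V v g → ∃ a ∈ A, ∀ z ∈ W, g • z = a • z := by
  -- Only finitely many relations between germs, with `b ∈ N` and representatives in `insert 1 A`,
  -- are ever used along a path. One neighbourhood serves all of them; `1` starts the induction.
  have hev : ∀ᶠ z in 𝓝 x, ∀ b ∈ N, ∀ a ∈ insert 1 A, ∀ a' ∈ A,
      (∀ᶠ z in 𝓝 x, (b * a) • z = a' • z) → (b * a) • z = a' • z := by
    rw [Filter.eventually_all_finite hN.finite]
    intro b _
    rw [Filter.eventually_all_finite (hA.insert 1)]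
    intro a _
    rw [Filter.eventually_all_finite hA]
    intro a' _
    by_cases hc : ∀ᶠ z in 𝓝 x, (b * a) • z = a' • z
    · exact hc.mono fun z hz _ => hz
    · exact Filter.Eventually.of_forall fun z hz => absurd hz hc
  refine ⟨_, hev, fun g hg => ?_⟩
  -- The germ equality is carried along to supply the relation needed at the next step.
  suffices ∃ a ∈ A, (∀ᶠ z in 𝓝 x, g • z = a • z) ∧ ∀ z ∈ {z : X.Boundary | ∀ b ∈ N,
      ∀ a ∈ insert 1 A, ∀ a' ∈ A,
      (∀ᶠ z in 𝓝 x, (b * a) • z = a' • z) → (b * a) • z = a' • z}, g • z = a • z from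
    this.imp fun a ha => ⟨ha.1, ha.2.2⟩
  induction hg with
  | one hv =>
    obtain ⟨a, ha, hxa⟩ := h 1 (.one hv)
    refine ⟨a, ha, hxa, fun z hz => ?_⟩
    have := hz 1 hN.one_mem 1 (Set.mem_insert 1 A) a ha (by rwa [one_mul])
    rwa [one_mul] at this
  | @step g b hg hb hV ih =>
    obtain ⟨a, ha, hxa, hWa⟩ := ih
    have hb' : b ∈ N := hb.elim id fun h => by simpa using hN.inv_mem _ h
    obtain ⟨a', ha', hxa'⟩ := h (b * g) (hg.step hb hV)
    have hba : ∀ᶠ z in 𝓝 x, (b * a) • z = a' • z := by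
      filter_upwards [hxa, hxa'] with z h1 h2
      rw [← h2, mul_smul, mul_smul, h1]
    refine ⟨a', ha', hxa', fun z hz => ?_⟩
    rw [← hz b hb' a (Set.mem_insert_of_mem 1 ha) a' ha' hba, mul_smul, mul_smul, hWa z hz]

/-- By compactness finitely many uniform neighbourhoods suffice. A local product acts on its
cylinder as prescribed by a choice of an element of a finite set for each of them, so only finitely
many actions occur. -/
theorem IsCore.finiteGroupoid_of_germs (hN : X.IsCore N) [Nonempty X.Letter] {n : ℕ}
    {V : Set X.Word} (hV : ∀ v ∈ V, v.length = n) {A : Set G} (hA : A.Finite)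
    (h : ∀ (x : X.Boundary) (g : G), X.LocalGen N V (x.pre n) g →
      ∃ a ∈ A, ∀ᶠ z in 𝓝 x, g • z = a • z) : X.FiniteGroupoid N V := by
  choose W hW hWg using fun x => hN.exists_nhds_localGen hA x (h x)
  obtain ⟨t, -, ht⟩ := isCompact_univ.elim_nhds_subcover
    (fun x : X.Boundary => W x ∩ {y | y.pre n ∈ ({x.pre n} : Set X.Word)})
    (fun x _ => Filter.inter_mem (hW x) ((X.isClopen_pre n _).2.mem_nhds rfl))
  have hφ : ∀ (p : X.Word × G) (x : t), ∃ a ∈ insert 1 A, X.LocalGen N V p.1 p.2 →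
      x.1.pre n = p.1 → ∀ z ∈ W x, p.2 • z = a • z := by
    intro p x
    by_cases hp : X.LocalGen N V p.1 p.2 ∧ x.1.pre n = p.1
    · obtain ⟨a, ha, haW⟩ := hWg x p.2 (by rw [hp.2]; exact hp.1)
      exact ⟨a, Set.mem_insert_of_mem 1 ha, fun _ _ => haW⟩
    · exact ⟨1, Set.mem_insert 1 A, fun h1 h2 => absurd ⟨h1, h2⟩ hp⟩
  choose φ hφA hφ using hφ
  obtain ⟨R, hRT, hR, hrep⟩ := exists_finite_representatives
    {p : X.Word × G | X.LocalGen N V p.1 p.2} (fun p => (p.1, φ p)) (by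
      refine ((X.finite_length_eq n).prod (Set.Finite.pi' fun _ : t => hA.insert 1)).subset ?_
      rintro _ ⟨p, hp, rfl⟩
      exact ⟨hV _ hp.source_mem, fun x => hφA p x⟩)
  refine (finiteGroupoid_iff ((X.finite_length_eq n).subset hV)).mpr
    ⟨_, hR.image fun p => X.sec p.2 p.1, fun v g hg => ?_⟩
  obtain ⟨⟨w, q⟩, hwq, he⟩ := hrep (v, g) hg
  obtain ⟨rfl, he⟩ := Prod.mk.inj he
  refine ⟨_, ⟨_, hwq, rfl⟩, act_sec_eq_of_smul_eq fun x hx => ?_⟩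
  rw [hV _ hg.source_mem] at hx
  obtain ⟨y, hy⟩ := Set.mem_iUnion.mp (ht (Set.mem_univ x))
  obtain ⟨hyt, hxW, hxy⟩ := Set.mem_iUnion.mp hy
  change x.pre n = y.pre n at hxy
  have hyw := hxy.symm.trans hx
  have h1 := hφ (w, g) ⟨y, hyt⟩ hg hyw x hxW
  have h2 := hφ (w, q) ⟨y, hyt⟩ (hRT hwq) hyw x hxW
  rw [← he] at h1
  exact h1.trans h2.symm

theorem LocalGen.mk_mem_arrows {A : Set G} {V : Set X.Word} {n : ℕ} {x : X.Boundary} {g : G}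
    (hg : X.LocalGen A V (x.pre n) g) (H : Subgroupoid X.Boundary)
    (hH : ∀ a, (a ∈ A ∨ a⁻¹ ∈ A ∨ a = 1) → ∀ x : X.Boundary, x.pre n ∈ V → X.act a (x.pre n) ∈ V →
      (Quotient.mk (X.germSetoid x (a • x)) ⟨a, rfl⟩ : x ⟶ a • x) ∈ H.arrows x (a • x)) :
    ∀ (y : X.Boundary) (e : g • x = y),
      (Quotient.mk (X.germSetoid x y) ⟨g, e⟩ : x ⟶ y) ∈ H.arrows x y := by
  induction hg with
  | one hv =>
    rintro _ rfl
    exact hH 1 (Or.inr (Or.inr rfl)) x hv (by rwa [act_one])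
  | @step g a hg ha hV ih =>
    intro y e
    have e' : y = a • g • x := by rw [← e, mul_smul]
    subst e'
    have h1 := ih _ rfl
    have h2 := hH a (ha.imp id Or.inl) (g • x) (by rw [pre_smul]; exact hg.target_mem)
      (by rw [pre_smul, ← act_mul]; exact hV)
    exact H.mul h1 h2

theorem IsCore.hasFinitePartition_of_dadProperty (hN : X.IsCore N) {d : ℕ}
    (h : DadProperty X.Boundary d) : X.HasFinitePartition N d := by
  rcases isEmpty_or_nonempty X.Letter with hX | hX
  · exact hasFinitePartition_of_isEmpty N d
  obtain ⟨U, hU, hcov, hH⟩ := h (⋃ a ∈ N, Set.range fun x : X.Boundary => X.germ (a, x))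
    (hN.finite.isCompact_biUnion fun a _ => isCompact_range (X.continuous_germ a))
  choose H hHc hHK using hH
  obtain ⟨n, hn, hleb⟩ := exists_cylinder_lebesgue (fun i => isOpen_unitTopology_iff.mp (hU i)) hcov
  -- At a Lebesgue level every cylinder lies in some `U i`; one such index is the colour.
  have hcol : ∀ v : X.Word, ∃ i, v.length = n → ∀ y : X.Boundary, y.pre n = v → y ∈ U i := by
    intro v
    obtain ⟨x, hx⟩ := exists_pre_eq v
    obtain ⟨i, hi⟩ := hleb x
    refine ⟨i, fun hv y hy => hi ?_⟩
    change y.pre n = x.pre n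
    rw [hy, ← hx, hv]
  choose i hi using hcol
  refine ⟨n, hn, fun j => {v | v.length = n ∧ i v = j}, ?_, ?_, fun j => ?_⟩
  · ext v
    simp
  · intro j k hjk
    exact Set.disjoint_left.mpr fun v hv hv' => hjk (hv.2.symm.trans hv'.2)
  · obtain ⟨A, hA, hAH⟩ := exists_finite_germ (hHc j)
    refine hN.finiteGroupoid_of_germs (fun v hv => hv.1) hA fun x g hg => ?_
    have hmem := hg.mk_mem_arrows (H j) (fun a ha z hz haz => by
      have haN : a ∈ N := by
        rcases ha with ha | ha | rfl
        · exact ha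
        · simpa using hN.inv_mem _ ha
        · exact hN.one_mem
      refine hHK j (X.germ (a, z)) (Set.mem_iUnion₂.mpr ⟨a, haN, z, rfl⟩) ?_ ?_
      · have := hi _ hz.1 z rfl
        rwa [hz.2] at this
      · have := hi _ haz.1 (a • z) (X.pre_smul a z n)
        rwa [haz.2] at this) _ rfl
    obtain ⟨a, ha, y, hy⟩ := hAH (X.germ (g, x)) hmem
    exact ⟨a, ha, (germ_eq_germ_iff.mp hy).2⟩

end SelfSimilar

end BisetBasis

/-! ### The dynamical asymptotic dimension -/

theorem DadProperty.mono {C : Type v} [Groupoid.{u} C] [TopologicalSpace (Quiver.Total C)]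
    {d e : ℕ} (h : DadProperty C d) (hde : d ≤ e) : DadProperty C e := by
  intro K hK
  obtain ⟨U, hU, hcov, hH⟩ := h K hK
  -- The last set is repeated for the surplus indices.
  refine ⟨fun i => U ⟨min i.1 d, by omega⟩, fun i => hU _, ?_, fun i => hH _⟩
  refine Set.eq_univ_of_forall fun x => ?_
  obtain ⟨i, hi⟩ := Set.mem_iUnion.mp (hcov.symm ▸ Set.mem_univ x : x ∈ ⋃ i, U i)
  refine Set.mem_iUnion.mpr ⟨⟨i.1, by omega⟩, ?_⟩
  convert hi using 3
  have := i.2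
  simp only
  omega

theorem dynAsympDim_le_iff {C : Type v} [Groupoid.{u} C] [TopologicalSpace (Quiver.Total C)]
    {d : ℕ} : dynAsympDim C ≤ d ↔ DadProperty C d := by
  constructor
  · intro h
    by_contra hcon
    have : ((d + 1 : ℕ) : ℕ∞) ≤ dynAsympDim C := by
      refine le_iInf₂ fun e he => ?_
      have : d + 1 ≤ e := by
        by_contra! hlt
        exact hcon (he.mono (by omega))
      exact_mod_cast this
    have h1 := this.trans h
    have h2 : d + 1 ≤ d := by exact_mod_cast h1
    omega
  · intro h
    exact iInf₂_le d h

theorem mainTheorem2 {G : Type u} {B : Type v} [Group G] [MulAction G B] [MulAction Gᵐᵒᵖ B]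
    [SMulCommClass G Gᵐᵒᵖ B] [SelfSimilarGroup G B] (hG : IsContracting G B)
    (X : BisetBasis G B) (d : ℕ) :
    List.TFAE [
      CoveringDimLE X.LimitSpace d,
      ∀ A : Set G, A.Finite → X.HasFinitePartition A d,
      X.HasFinitePartition X.nucleus d,
      dynAsympDim X.Boundary ≤ d] := by
  have hex := BisetBasis.exists_absorbs_of_isContracting hG X
  have hnuc := (X.isLeast_nucleus hex).1
  obtain ⟨N, hN⟩ := X.exists_isCore hex
  tfae_have 1 → 2 := fun h A hA =>
    (hN.hasFinitePartition_of_coveringDimLE h).of_absorbs hN.absorbs hA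
  tfae_have 2 → 3 := fun h => h _ hnuc.1
  -- The cover argument uses generators from `N * N`; the nucleus is absorbing, so its partition
  -- yields one for this finite set.
  tfae_have 3 → 1 := fun h =>
    hN.coveringDimLE (h.of_absorbs hnuc.2 (hN.finite.mul hN.finite))
  tfae_have 2 → 4 := fun h =>
    dynAsympDim_le_iff.mpr (BisetBasis.dadProperty_of_hasFinitePartition h)
  tfae_have 4 → 2 := fun h A hA =>
    (hN.hasFinitePartition_of_dadProperty (dynAsympDim_le_iff.mp h)).of_absorbs hN.absorbs hA
  tfae_finish
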